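/- Let $(G_i)_{i\ge 1}$ be a sequence of finite simple graphs, $G_i$ having $n_i$ vertices and maximum degree $\Delta_i$, with $n_i\to\infty$ and $\Delta_i=o(n_i)$. Let $\Omega(G_i)$ be the set of proper $(\Delta_i+1)$-colourings of $G_i$, and let $\Omega^*(G_i)\subseteq\Omega(G_i)$ be the set of frozen ones, i.e. those in which every one of the $\Delta_i+1$ colours appears in the closed neighbourhood of every vertex. Glauber dynamics on $\Omega(G_i)$ is the Markov chain that, at each step, chooses a vertex $v$ and a colour $c$ independently and uniformly at random, and recolours $v$ with $c$ if $c$ does not appear on a neighbour of $v$, and otherwise does nothing. Let $P_i$ be its transition matrix, and let $\|\cdot\|_{TV}$ be the total variation distance, $\|\mu-\nu\|_{TV}=\max_A|\mu(A)-\nu(A)|$. 1. If $X_0$ is uniform on $\Omega(G_i)$, then $X_t$ is almost uniform: for every $\varepsilon>0$, for all sufficiently large $i$ and all $t\ge 0$, the law of $X_t$ is within total variation distance $\varepsilon$ of the uniform distribution on $\Omega(G_i)$. 2. Assume moreover that every $G_i$ is connected and that $\Delta_i\ge 3$. Then Glauber dynamics started at a uniformly random colouring is an almost uniform sampler also conditionally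 on its start: for every $\varepsilon>0$ and all sufficiently large $i$ there is a $T$ such that, with probability at least $1-\varepsilon$ over a uniformly random $\alpha\in\Omega(G_i)$, $$\|P_i^t(\alpha,\cdot)-\mathrm{Unif}(\Omega(G_i))\|_{TV}\le\varepsilon\quad\text{for all } t\ge T.$$ Moreover: (a) $|\Omega^*(G_i)|/|\Omega(G_i)|\to 0$ as $i\to\infty$; (b) for every $i$ and every $\alpha\in\Omega(G_i)\setminus\Omega^*(G_i)$, $\|P_i^t(\alpha,\cdot)-\mathrm{Unif}(\Omega(G_i)\setminus\Omega^*(G_i))\|_{TV}\to 0$ as $t\to\infty$; (c) $\|\mathrm{Unif}(\Omega(G_i)\setminus\Omega^*(G_i))-\mathrm{Unif}(\Omega(G_i))\|_{TV}\to 0$ as $i\to\infty$. -/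

import Mathlib

open Filter Topology

noncomputable section

namespace GlauberColouring

variable {V : Type*} [Fintype V] {k : ℕ}

open Classical in
/-- One update of Glauber dynamics with the chosen vertex `v` and colour `c`: the vertex `v` is
recoloured with `c` if `c` does not appear on the neighbours of `v`; otherwise nothing changes. -/
def recolour (G : SimpleGraph V) (α : G.Coloring (Fin k)) (v : V) (c : Fin k) :
    G.Coloring (Fin k) :=
  if h : ∀ u, G.Adj v u → α u ≠ c then
    SimpleGraph.Coloring.mk (Function.update α v c) (by
      intro x y hxy
      by_cases hx : x = v
      · subst hx
        have hy : y ≠ x := hxy.ne'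
        simpa [Function.update_of_ne hy] using (h y hxy).symm
      · by_cases hy : y = v
        · subst hy
          simpa [Function.update_of_ne hx] using h x hxy.symm
        · simpa [Function.update_of_ne hx, Function.update_of_ne hy] using α.valid hxy)
  else α

open Classical in
/-- The transition matrix of Glauber dynamics for `k`-colourings of `G`: the entry `(α, β)` is the
probability that updating `α` at a pair `(v, c)`, uniform in `V × Fin k`, produces `β`. -/
def transition (G : SimpleGraph V) (k : ℕ) :
    Matrix (G.Coloring (Fin k)) (G.Coloring (Fin k)) ℝ :=
  Matrix.of fun α β =>
    ((Finset.univ.filter fun p : V × Fin k => recolour G α p.1 p.2 = β).card : ℝ) /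
      ((Fintype.card V : ℝ) * (k : ℝ))

open Classical in
/-- The law of `X_t`, for Glauber dynamics `X_0, X_1, …` with initial law `μ`. -/
def law (G : SimpleGraph V) (k : ℕ) (μ : G.Coloring (Fin k) → ℝ) (t : ℕ) :
    G.Coloring (Fin k) → ℝ :=
  Matrix.vecMul μ (transition G k ^ t)

open Classical in
/-- The point mass at `x`. -/
def pointMass {Ω : Type*} (x : Ω) : Ω → ℝ := fun y => if y = x then 1 else 0

open Classical in
/-- The uniform distribution on a nonempty finite set `S ⊆ Ω`. -/
def uniformOn {Ω : Type*} (S : Finset Ω) : Ω → ℝ := fun x => if x ∈ S then 1 / (S.card : ℝ) else 0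

/-- Total variation distance: the maximum over all events `A` of `|μ(A) - ν(A)|`. -/
def tvDist {Ω : Type*} [Fintype Ω] (μ ν : Ω → ℝ) : ℝ :=
  ⨆ A : Finset Ω, |∑ x ∈ A, μ x - ∑ x ∈ A, ν x|

/-- A colouring is frozen if every colour appears in the closed neighbourhood of every vertex. -/
def IsFrozen (G : SimpleGraph V) (α : G.Coloring (Fin k)) : Prop :=
  ∀ (v : V) (c : Fin k), ∃ u, (u = v ∨ G.Adj v u) ∧ α u = c

/-- The set `Ω(G)` of all `k`-colourings of `G`. -/
def colourings (G : SimpleGraph V) (k : ℕ) : Finset (G.Coloring (Fin k)) := Finset.univ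

open Classical in
/-- The set `Ω*(G)` of frozen `k`-colourings of `G`. -/
def frozen (G : SimpleGraph V) (k : ℕ) : Finset (G.Coloring (Fin k)) :=
  Finset.univ.filter fun α => IsFrozen G α

open Classical in
/-- The set `Ω(G) \ Ω*(G)` of non-frozen `k`-colourings of `G`. -/
def nonFrozen (G : SimpleGraph V) (k : ℕ) : Finset (G.Coloring (Fin k)) :=
  Finset.univ.filter fun α => ¬ IsFrozen G α

open Classical in
/-- The starting colourings `α` for which, from time `T` on, the law of Glauber dynamics started
at `α` is within total variation distance `ε` of the uniform distribution on `Ω(G)`. -/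
def goodStarts (G : SimpleGraph V) (k : ℕ) (ε : ℝ) (T : ℕ) : Finset (G.Coloring (Fin k)) :=
  Finset.univ.filter fun α =>
    ∀ t, T ≤ t → tvDist (law G k (pointMass α) t) (uniformOn (colourings G k)) ≤ ε

end GlauberColouring

end

/-! With `k = Δ + 1`, the transition matrix is symmetric, since a recolouring and its reversal have
the same probability. Hence the uniform law on all colourings is stationary, which settles the first
claim.

The second claim rests on a reconfiguration theorem, `reach_of_free`: for a connected graph and `k ≥
4`, single-vertex recolourings connect all non-frozen colourings. If some vertex has degree below `k
- 1`, a degeneracy argument suffices (`connected_of_degenerate`). In the regular case, freeness can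
be carried to any chosen vertex, and two neighbours of that vertex then share a colour. While these
two leaves of a "cherry" keep a common colour, the component of its centre in the rest of the graph
is degenerate, so its colours can be rearranged at will (`reach_of_eq_off_comp`). Several cherries
whose components contain each other's leaves allow every colouring to be brought to prescribed
colours on the leaves, after which `reach_of_cover` connects the results. Such systems come from two
interlocking cherries, an induced claw, or a triangle with pendant edges, and a regular graph
containing a cherry has one of the three (`not_noConfiguration`).

Non-frozen colourings are closed under the dynamics, and the chain has positive diagonal.
Irreducibility and a Doeblin contraction therefore give (b).

For (a), exchanging the colours of two suitable adjacent vertices of a frozen colouring unfreezes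
it. There is one such exchange per vertex, and each non-frozen colouring arises at most `2k` times
(`card_frozen_mul_le`). The frozen fraction is thus at most `2k/n`, which tends to `0`. Then (c) is
a direct `ℓ¹` computation, and the conditional sampling statement follows by the triangle
inequality, with the non-frozen colourings as good starts. -/

namespace GlauberColouring

/-! ### List colourings and recolouring of degenerate graphs. -/

section ListRecolouring

open scoped Classical
open Function Relation

variable {V : Type*} {k : ℕ}

/-- `f` is a proper colouring of `G[U]` from the lists `L`. -/
def Valid (G : SimpleGraph V) (U : Finset V) (L : V → Finset (Fin k)) (f : V → Fin k) : Prop :=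
  ∀ u ∈ U, f u ∈ L u ∧ ∀ w ∈ U, G.Adj u w → f u ≠ f w

/-- Two list colourings of `G[U]` that differ by the recolouring of one vertex of `U`. -/
def Move (G : SimpleGraph V) (U : Finset V) (L : V → Finset (Fin k)) (f g : V → Fin k) : Prop :=
  Valid G U L f ∧ Valid G U L g ∧ ∃ u ∈ U, ∃ c, g = update f u c

theorem Valid.mono {G : SimpleGraph V} {U U' : Finset V} {L : V → Finset (Fin k)} {f : V → Fin k}
    (h : Valid G U' L f) (hU : U ⊆ U') : Valid G U L f :=
  fun u hu => ⟨(h u (hU hu)).1, fun w hw => (h u (hU hu)).2 w (hU hw)⟩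

theorem Valid.congr {G : SimpleGraph V} {U : Finset V} {L : V → Finset (Fin k)} {f g : V → Fin k}
    (h : Valid G U L f) (hfg : ∀ u ∈ U, g u = f u) : Valid G U L g := fun u hu =>
  ⟨hfg u hu ▸ (h u hu).1, fun w hw huw => by
    rw [hfg u hu, hfg w hw]; exact (h u hu).2 w hw huw⟩

theorem Valid.update_insert {G : SimpleGraph V} {U : Finset V} {L : V → Finset (Fin k)}
    {f : V → Fin k} {v : V} {c : Fin k} (h : Valid G U L f) (hv : v ∉ U) (hc : c ∈ L v)
    (hn : ∀ w ∈ U, G.Adj v w → f w ≠ c) : Valid G (insert v U) L (update f v c) := by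
  intro u hu
  have key : ∀ w ∈ U, update f v c w = f w := fun w hw =>
    update_of_ne (by rintro rfl; exact hv hw) _ _
  rcases Finset.mem_insert.1 hu with rfl | hu'
  · refine ⟨by simpa using hc, fun w hw huw => ?_⟩
    rcases Finset.mem_insert.1 hw with rfl | hw
    · exact absurd huw (G.loopless.irrefl _)
    · rw [key w hw, update_self]; exact (hn w hw huw).symm
  · rw [key u hu']
    refine ⟨(h u hu').1, fun w hw huw => ?_⟩
    rcases Finset.mem_insert.1 hw with rfl | hw
    · rw [update_self]; exact hn u hu' huw.symm
    · rw [key w hw]; exact (h u hu').2 w hw huw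

variable [Fintype V]

/-- The neighbours of `v`, as a finset. -/
noncomputable def nbhd (G : SimpleGraph V) (v : V) : Finset V := Finset.univ.filter (G.Adj v)

@[simp] theorem mem_nbhd {G : SimpleGraph V} {v w : V} : w ∈ nbhd G v ↔ G.Adj v w := by
  simp [nbhd]

/-- A sequence of moves on `U` lifts to `insert v U` if the list of `v` has room to dodge. -/
theorem lift_moves {G : SimpleGraph V} {U : Finset V} {L : V → Finset (Fin k)} {v : V}
    (hv : v ∉ U) (hL : (nbhd G v ∩ U).card + 2 ≤ (L v).card) {f h f' : V → Fin k}
    (hp : ReflTransGen (Move G U L) f h) (hf' : Valid G (insert v U) L f')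
    (hff : ∀ w, w ≠ v → f' w = f w) :
    ∃ h', Valid G (insert v U) L h' ∧ (∀ w, w ≠ v → h' w = h w) ∧
      ReflTransGen (Move G (insert v U) L) f' h' := by
  induction hp with
  | refl => exact ⟨f', hf', hff, .refl⟩
  | @tail g h _ hmove ih =>
    obtain ⟨g', hg', hgg, hpath⟩ := ih
    obtain ⟨hgv, hhv, u, hu, c, rfl⟩ := hmove
    have huv : u ≠ v := fun e => hv (e ▸ hu)
    -- Before `u` receives `c`, `v` steps aside to a colour `d` that avoids `c` and the current
    -- colours of its neighbours. The slack of 2 in the list is what provides `d`.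
    obtain ⟨d, hd, hdc⟩ : ∃ d ∈ L v, d ≠ c ∧ ∀ w ∈ U, G.Adj v w → g w ≠ d := by
      have : (insert c ((nbhd G v ∩ U).image g)).card < (L v).card := by
        have h1 := Finset.card_insert_le c ((nbhd G v ∩ U).image g)
        have h2 : ((nbhd G v ∩ U).image g).card ≤ _ := Finset.card_image_le
        omega
      obtain ⟨d, hd, hd'⟩ := Finset.exists_mem_notMem_of_card_lt_card this
      simp only [Finset.mem_insert, Finset.mem_image, Finset.mem_inter, mem_nbhd, not_or,
        not_exists, not_and, and_imp] at hd'
      exact ⟨d, hd, hd'.1, fun w hw hvw => hd'.2 w hvw hw⟩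
    have hg1 : Valid G (insert v U) L (update g v d) := hgv.update_insert hv hd hdc.2
    have e1 : update g' v d = update g v d := by
      funext w; by_cases hw : w = v
      · subst hw; simp
      · simp [hw, hgg w hw]
    have hg2 : Valid G (insert v U) L (update (update g v d) u c) := by
      rw [update_comm huv.symm]
      refine hhv.update_insert hv hd fun w hw hvw => ?_
      by_cases hwu : w = u
      · subst hwu; simpa using hdc.1.symm
      · simpa [hwu] using hdc.2 w hw hvw
    refine ⟨update (update g v d) u c, hg2, fun w hw => ?_, ?_⟩
    · by_cases hwu : w = u
      · subst hwu; simp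
      · simp [hwu, hw]
    · refine (hpath.tail (c := update g v d) ⟨hg', hg1, v, Finset.mem_insert_self _ _, d, e1.symm⟩).tail ?_
      exact ⟨hg1, hg2, u, Finset.mem_insert_of_mem hu, c, rfl⟩

/-- Induction on `U`: remove a vertex `v` with slack, connect the restrictions to the rest, lift the
path so that `v` dodges each move, and finally give `v` its target colour. -/
theorem connected_of_degenerate {G : SimpleGraph V} {L : V → Finset (Fin k)} (U : Finset V)
    (hU : ∀ W ⊆ U, W.Nonempty → ∃ s ∈ W, (nbhd G s ∩ W).card + 2 ≤ (L s).card)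
    {f g : V → Fin k} (hf : Valid G U L f) (hg : Valid G U L g) (hfg : ∀ w, w ∉ U → f w = g w) :
    ReflTransGen (Move G U L) f g := by
  induction hn : U.card generalizing U f g with
  | zero =>
    rw [Finset.card_eq_zero] at hn
    subst hn
    rw [show f = g from funext fun w => hfg w (by simp)]
  | succ n ih =>
    obtain ⟨v, hvU, hv⟩ := hU U subset_rfl (Finset.card_pos.1 (by omega))
    obtain ⟨U, hvU', rfl⟩ : ∃ U', v ∉ U' ∧ insert v U' = U :=
      ⟨U.erase v, by simp, Finset.insert_erase hvU⟩
    have hsub : U ⊆ insert v U := Finset.subset_insert _ _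
    have hcard : U.card = n := by rw [Finset.card_insert_of_notMem hvU'] at hn; omega
    have hg1 : Valid G U L (update g v (f v)) :=
      (hg.mono hsub).congr fun u hu => update_of_ne (by rintro rfl; exact hvU' hu) _ _
    have hL : (nbhd G v ∩ U).card + 2 ≤ (L v).card :=
      (Nat.add_le_add_right (Finset.card_le_card
        (Finset.inter_subset_inter_left hsub)) 2).trans hv
    have hp := ih U (fun W hW => hU W (hW.trans hsub)) (hf.mono hsub) hg1 (fun w hw => by
      by_cases hwv : w = v
      · subst hwv; simp
      · rw [update_of_ne hwv]; exact hfg w (by simp [hwv, hw])) hcard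
    obtain ⟨h', hv', hh, hpath⟩ := lift_moves hvU' hL hp hf (fun _ _ => rfl)
    refine hpath.tail ⟨hv', hg, v, Finset.mem_insert_self _ _, g v, ?_⟩
    funext w
    by_cases hw : w = v
    · subst hw; simp
    · simp [hw, hh w hw]

/-- Greedy colouring: the removed vertex is coloured last, and slack 1 leaves it a colour. -/
theorem exists_valid_of_degenerate {G : SimpleGraph V} {L : V → Finset (Fin k)} (U : Finset V)
    (hU : ∀ W ⊆ U, W.Nonempty → ∃ s ∈ W, (nbhd G s ∩ W).card + 1 ≤ (L s).card)
    (f : V → Fin k) : ∃ g, (∀ w, w ∉ U → g w = f w) ∧ Valid G U L g := by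
  induction hn : U.card generalizing U with
  | zero =>
    rw [Finset.card_eq_zero] at hn
    subst hn
    exact ⟨f, fun _ _ => rfl, fun u hu => by simp at hu⟩
  | succ n ih =>
    obtain ⟨v, hvU, hv⟩ := hU U subset_rfl (Finset.card_pos.1 (by omega))
    obtain ⟨U, hvU', rfl⟩ : ∃ U', v ∉ U' ∧ insert v U' = U :=
      ⟨U.erase v, by simp, Finset.insert_erase hvU⟩
    have hsub : U ⊆ insert v U := Finset.subset_insert _ _
    have hcard : U.card = n := by rw [Finset.card_insert_of_notMem hvU'] at hn; omega
    obtain ⟨g, hgf, hg⟩ := ih U (fun W hW => hU W (hW.trans hsub)) hcard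
    have hlt : ((nbhd G v ∩ U).image g).card < (L v).card := by
      have h2 : ((nbhd G v ∩ U).image g).card ≤ _ := Finset.card_image_le
      have := Finset.card_le_card
        (Finset.inter_subset_inter_left (s := nbhd G v) hsub)
      omega
    obtain ⟨d, hd, hd'⟩ := Finset.exists_mem_notMem_of_card_lt_card hlt
    simp only [Finset.mem_image, Finset.mem_inter, mem_nbhd, not_exists, not_and, and_imp] at hd'
    refine ⟨update g v d, fun w hw => ?_,
      hg.update_insert hvU' hd fun w hw hvw => hd' w hvw hw⟩
    simp only [Finset.mem_insert, not_or] at hw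
    rw [update_of_ne hw.1, hgf w hw.2]

end ListRecolouring

/-! ### Reachability of proper colourings, and cherries. -/

section Reachability

open scoped Classical
open Function Relation

variable {V : Type*} {k : ℕ}

/-- Proper colourings, as functions. -/
def Proper (G : SimpleGraph V) (f : V → Fin k) : Prop := ∀ u w, G.Adj u w → f u ≠ f w

/-- Two proper colourings that differ by the recolouring of one vertex. -/
def Step (G : SimpleGraph V) (f g : V → Fin k) : Prop :=
  Proper G f ∧ Proper G g ∧ ∃ u c, g = update f u c

/-- `g` is obtained from `f` by recolouring one vertex at a time. -/
def Reach (G : SimpleGraph V) : (V → Fin k) → (V → Fin k) → Prop := ReflTransGen (Step G)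

theorem Step.symm {G : SimpleGraph V} {f g : V → Fin k} (h : Step G f g) : Step G g f := by
  obtain ⟨hf, hg, u, c, rfl⟩ := h
  exact ⟨hg, hf, u, f u, by simp⟩

theorem Reach.symm {G : SimpleGraph V} {f g : V → Fin k} (h : Reach G f g) : Reach G g f := by
  induction h with
  | refl => exact .refl
  | tail _ hs ih => exact .head hs.symm ih

theorem Reach.trans {G : SimpleGraph V} {f g h : V → Fin k} (h₁ : Reach G f g)
    (h₂ : Reach G g h) : Reach G f h := ReflTransGen.trans h₁ h₂

theorem mem_of_closed {G : SimpleGraph V} (hG : G.Preconnected) {S : V → Prop} {a : V} (ha : S a)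
    (hS : ∀ u w, S u → G.Adj u w → S w) (v : V) : S v := by
  have := (SimpleGraph.reachable_iff_reflTransGen a v).1 (hG a v)
  induction this with
  | refl => exact ha
  | tail _ h ih => exact hS _ _ ih h

variable [Fintype V]

/-- The lists left to the vertices of `U` by the colouring `α` of the other vertices. -/
noncomputable def residualList (G : SimpleGraph V) (U : Finset V) (α : V → Fin k) (u : V) :
    Finset (Fin k) := ((nbhd G u \ U).image α)ᶜ

theorem card_residualList (G : SimpleGraph V) (U : Finset V) (α : V → Fin k) (u : V) :
    (residualList G U α u).card = k - ((nbhd G u \ U).image α).card := by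
  rw [residualList, Finset.card_compl, Fintype.card_fin]

theorem card_inter_add_sdiff_le {G : SimpleGraph V} {U W : Finset V} (hW : W ⊆ U) (s : V) :
    (nbhd G s ∩ W).card + (nbhd G s \ U).card ≤ (nbhd G s).card := by
  rw [← Finset.card_union_of_disjoint]
  · exact Finset.card_le_card (Finset.union_subset Finset.inter_subset_left Finset.sdiff_subset)
  · rw [Finset.disjoint_left]
    intro a ha hb
    exact (Finset.mem_sdiff.1 hb).2 (hW (Finset.mem_inter.1 ha).2)

theorem card_inter_add_sdiff_lt {G : SimpleGraph V} {U W : Finset V} (hW : W ⊆ U) {s t : V}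
    (ht : t ∈ U) (htW : t ∉ W) (hst : G.Adj s t) :
    (nbhd G s ∩ W).card + (nbhd G s \ U).card + 1 ≤ (nbhd G s).card := by
  rw [← Finset.card_union_of_disjoint, ← Finset.card_insert_of_notMem (a := t)]
  · refine Finset.card_le_card (Finset.insert_subset (by simpa using hst)
      (Finset.union_subset Finset.inter_subset_left Finset.sdiff_subset))
  · simp [htW, ht]
  · rw [Finset.disjoint_left]
    intro a ha hb
    exact (Finset.mem_sdiff.1 hb).2 (hW (Finset.mem_inter.1 ha).2)

theorem Proper.valid {G : SimpleGraph V} {U : Finset V} {α f : V → Fin k} (hf : Proper G f)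
    (hα : ∀ v, v ∉ U → f v = α v) : Valid G U (residualList G U α) f := by
  refine fun u _ => ⟨?_, fun w _ h => hf u w h⟩
  simp only [residualList, Finset.mem_compl, Finset.mem_image, Finset.mem_sdiff, mem_nbhd,
    not_exists, not_and, and_imp]
  intro w huw hw e
  rw [← hα w hw] at e
  exact hf u w huw e.symm

theorem Valid.proper {G : SimpleGraph V} {U : Finset V} {α f : V → Fin k}
    (hα : ∀ u w, u ∉ U → w ∉ U → G.Adj u w → α u ≠ α w)
    (hf : Valid G U (residualList G U α) f) (hfα : ∀ v, v ∉ U → f v = α v) : Proper G f := by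
  have key : ∀ u w, u ∈ U → G.Adj u w → f u ≠ f w := by
    intro u w hu huw
    by_cases hw : w ∈ U
    · exact (hf u hu).2 w hw huw
    · have := (hf u hu).1
      simp only [residualList, Finset.mem_compl, Finset.mem_image, Finset.mem_sdiff, mem_nbhd,
        not_exists, not_and, and_imp] at this
      rw [hfα w hw]
      exact fun e => this w huw hw e.symm
  intro u w huw
  by_cases hu : u ∈ U
  · exact key u w hu huw
  by_cases hw : w ∈ U
  · exact (key w u hw huw.symm).symm
  · rw [hfα u hu, hfα w hw]
    exact hα u w hu hw huw

theorem reach_of_moves {G : SimpleGraph V} {U : Finset V} {α f g : V → Fin k} (hα : Proper G α)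
    (hf : ∀ v, v ∉ U → f v = α v) (h : ReflTransGen (Move G U (residualList G U α)) f g) :
    Reach G f g ∧ ∀ v, v ∉ U → g v = α v := by
  induction h with
  | refl => exact ⟨.refl, hf⟩
  | @tail g h _ hm ih =>
    obtain ⟨hg, hh, u, hu, c, rfl⟩ := hm
    have hoff : ∀ v, v ∉ U → update g u c v = α v := fun v hv => by
      rw [update_of_ne (by rintro rfl; exact hv hu)]
      exact ih.2 v hv
    exact ⟨ih.1.tail ⟨hg.proper (fun _ _ _ _ => hα _ _) ih.2,
      hh.proper (fun _ _ _ _ => hα _ _) hoff, u, c, rfl⟩, hoff⟩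

/-- Outside `U` it is colours that are counted, not neighbours, so a colour repeated among the fixed
neighbours of a vertex yields the extra slack. -/
theorem reach_of_degenerate {G : SimpleGraph V} (U : Finset V) {α β : V → Fin k}
    (hα : Proper G α) (hβ : Proper G β) (hαβ : ∀ v, v ∉ U → β v = α v)
    (hU : ∀ W ⊆ U, W.Nonempty → ∃ s ∈ W,
      (nbhd G s ∩ W).card + ((nbhd G s \ U).image α).card + 2 ≤ k) : Reach G α β := by
  refine (reach_of_moves hα (fun _ _ => rfl) (connected_of_degenerate U (fun W hW hne => ?_)
    (hα.valid fun _ _ => rfl) (hβ.valid hαβ) fun v hv => (hαβ v hv).symm)).1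
  obtain ⟨s, hs, h⟩ := hU W hW hne
  exact ⟨s, hs, by rw [card_residualList]; omega⟩

theorem exists_proper_extend {G : SimpleGraph V} (hdeg : ∀ v, (nbhd G v).card + 1 ≤ k)
    (U : Finset V) {f : V → Fin k} (hf : ∀ u w, u ∉ U → w ∉ U → G.Adj u w → f u ≠ f w) :
    ∃ g, Proper G g ∧ ∀ v, v ∉ U → g v = f v := by
  obtain ⟨g, hgf, hg⟩ := exists_valid_of_degenerate (G := G) (L := residualList G U f) U
    (fun W hW ⟨s, hs⟩ => ⟨s, hs, by
      have h1 := card_inter_add_sdiff_le (G := G) hW s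
      have h2 : ((nbhd G s \ U).image f).card ≤ _ := Finset.card_image_le
      have := hdeg s
      rw [card_residualList]
      omega⟩) f
  exact ⟨g, hg.proper hf hgf, hgf⟩

/-- If some vertex has degree less than `k - 1`, all colourings are connected. -/
theorem reach_of_not_regular {G : SimpleGraph V} (hG : G.Preconnected)
    (hdeg : ∀ v, (nbhd G v).card + 1 ≤ k) {v : V} (hv : (nbhd G v).card + 1 < k)
    {α β : V → Fin k} (hα : Proper G α) (hβ : Proper G β) : Reach G α β := by
  refine reach_of_degenerate Finset.univ hα hβ (by simp) fun W _ hne => ?_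
  suffices ∃ s ∈ W, (nbhd G s ∩ W).card + 2 ≤ k by
    have he : ∀ s, nbhd G s \ Finset.univ = ∅ := fun s =>
      Finset.sdiff_eq_empty_iff_subset.2 (Finset.subset_univ _)
    simpa [he] using this
  -- A vertex of `W` with a neighbour outside has degree at most `k - 2` within `W`. If there is
  -- none, `W` is everything by connectivity and contains `v`.
  by_cases h : ∃ s ∈ W, ∃ t, t ∉ W ∧ G.Adj s t
  · obtain ⟨s, hs, t, ht, hst⟩ := h
    have := card_inter_add_sdiff_lt (Finset.subset_univ W) (Finset.mem_univ t) ht hst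
    exact ⟨s, hs, by have := hdeg s; omega⟩
  · push Not at h
    obtain ⟨a, ha⟩ := hne
    refine ⟨v, mem_of_closed hG ha (fun u w hu huw => ?_) v, ?_⟩
    · by_contra hw
      exact h u hu w hw huw
    · have : (nbhd G v ∩ W).card ≤ (nbhd G v).card :=
        Finset.card_le_card Finset.inter_subset_left
      omega

/-- `x` has the two nonadjacent neighbours `y` and `z`. -/
structure IsCherry (G : SimpleGraph V) (x y z : V) : Prop where
  left : G.Adj x y
  right : G.Adj x z
  ne : y ≠ z
  nadj : ¬ G.Adj y z

/-- The connected component of `x` in `G - {y, z}`. -/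
noncomputable def comp (G : SimpleGraph V) (x y z : V) : Finset V :=
  Finset.univ.filter (ReflTransGen (fun a b => G.Adj a b ∧ b ≠ y ∧ b ≠ z) x)

omit [Fintype V] in
theorem IsCherry.symm {G : SimpleGraph V} {x y z : V} (h : IsCherry G x y z) : IsCherry G x z y :=
  ⟨h.right, h.left, h.ne.symm, fun e => h.nadj e.symm⟩

theorem comp_comm (G : SimpleGraph V) (x y z : V) : comp G x y z = comp G x z y := by
  simp only [comp, and_comm]

theorem self_mem_comp (G : SimpleGraph V) (x y z : V) : x ∈ comp G x y z := by
  simp [comp, ReflTransGen.refl]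

theorem comp_adj {G : SimpleGraph V} {x y z v w : V} (hv : v ∈ comp G x y z) (h : G.Adj v w)
    (hy : w ≠ y) (hz : w ≠ z) : w ∈ comp G x y z := by
  simp only [comp, Finset.mem_filter, Finset.mem_univ, true_and] at *
  exact hv.tail ⟨h, hy, hz⟩

theorem left_notMem_comp {G : SimpleGraph V} {x y z : V} (h : x ≠ y) : y ∉ comp G x y z := by
  simp only [comp, Finset.mem_filter, Finset.mem_univ, true_and]
  intro hr
  rcases ReflTransGen.cases_tail hr with e | ⟨_, _, h'⟩
  · exact h e.symm
  · exact h'.2.1 rfl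

theorem right_notMem_comp {G : SimpleGraph V} {x y z : V} (h : x ≠ z) : z ∉ comp G x y z := by
  rw [comp_comm]
  exact left_notMem_comp h

theorem exists_adj_sdiff_of_subset_comp {G : SimpleGraph V} {x y z : V} {W : Finset V}
    (hW : W ⊆ comp G x y z) (hne : W.Nonempty) (hx : x ∉ W) :
    ∃ s ∈ W, ∃ t ∈ comp G x y z, t ∉ W ∧ G.Adj s t := by
  by_contra! hcon
  have key : ∀ v, ReflTransGen (fun a b => G.Adj a b ∧ b ≠ y ∧ b ≠ z) x v → v ∉ W := by
    intro v hv
    induction hv with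
    | refl => exact hx
    | @tail a b ha hab ih =>
      intro hb
      exact hcon b hb a (by simpa [comp] using ha) ih hab.1.symm
  obtain ⟨a, ha⟩ := hne
  exact key a (by simpa [comp] using hW ha) ha

/-- While the two leaves of a cherry keep the same colour, the component of its centre is
flexible. -/
theorem reach_of_eq_off_comp {G : SimpleGraph V} (hdeg : ∀ v, (nbhd G v).card + 1 ≤ k)
    {x y z : V} (hc : IsCherry G x y z) {α β : V → Fin k} (hα : Proper G α) (hβ : Proper G β)
    (hyz : α y = α z) (hαβ : ∀ v, v ∉ comp G x y z → β v = α v) : Reach G α β := by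
  refine reach_of_degenerate _ hα hβ hαβ fun W hW hne => ?_
  -- The centre has two fixed neighbours of a single colour, which saves one. If `W` misses the
  -- centre, some vertex of `W` has a neighbour in the component but outside `W`, which saves one as
  -- well.
  by_cases hx : x ∈ W
  · refine ⟨x, hx, ?_⟩
    have hsub : nbhd G x \ comp G x y z ⊆ {y, z} := by
      intro w hw
      simp only [Finset.mem_sdiff, mem_nbhd] at hw
      by_contra hn
      simp only [Finset.mem_insert, Finset.mem_singleton, not_or] at hn
      exact hw.2 (comp_adj (self_mem_comp G x y z) hw.1 hn.1 hn.2)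
    have h1 : ((nbhd G x \ comp G x y z).image α).card ≤ 1 := by
      refine (Finset.card_le_card (Finset.image_subset_image hsub)).trans ?_
      simp [Finset.image_insert, hyz]
    have h2 : (nbhd G x ∩ W).card + 2 ≤ (nbhd G x).card := by
      rw [← Finset.card_pair hc.ne, ← Finset.card_union_of_disjoint]
      · refine Finset.card_le_card (Finset.union_subset Finset.inter_subset_left ?_)
        intro w hw
        simp only [Finset.mem_insert, Finset.mem_singleton] at hw
        rcases hw with rfl | rfl
        · simpa using hc.left
        · simpa using hc.right
      · rw [Finset.disjoint_right]
        intro w hw hw'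
        have hwW := hW (Finset.mem_inter.1 hw').2
        simp only [Finset.mem_insert, Finset.mem_singleton] at hw
        rcases hw with rfl | rfl
        · exact left_notMem_comp hc.left.ne hwW
        · exact right_notMem_comp hc.right.ne hwW
    have := hdeg x
    omega
  · obtain ⟨s, hs, t, ht, htW, hst⟩ := exists_adj_sdiff_of_subset_comp hW hne hx
    refine ⟨s, hs, ?_⟩
    have h1 := card_inter_add_sdiff_lt hW ht htW hst
    have h2 : ((nbhd G s \ comp G x y z).image α).card ≤ _ := Finset.card_image_le
    have := hdeg s
    omega

/-- While the two leaves of a cherry keep the same colour, the colours in the component of its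
centre can be prescribed. -/
theorem exists_reach_prescribed {G : SimpleGraph V} (hdeg : ∀ v, (nbhd G v).card + 1 ≤ k)
    {x y z : V} (hc : IsCherry G x y z) {α : V → Fin k} (hα : Proper G α)
    (hyz : α y = α z) (P : Finset V) (h : V → Fin k)
    (hP : ∀ p ∈ P, ∀ q ∈ P, G.Adj p q → h p ≠ h q)
    (hoff : ∀ p ∈ P, p ∉ comp G x y z → h p = α p)
    (hin : ∀ p ∈ P, p ∈ comp G x y z → G.Adj p y ∨ G.Adj p z → h p ≠ α y) :
    ∃ β, Proper G β ∧ Reach G α β ∧ (∀ v, v ∉ comp G x y z → β v = α v) ∧ ∀ p ∈ P, β p = h p := by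
  have key : ∀ a b, a ∈ P → b ∉ P → b ∉ comp G x y z → G.Adj a b → h a ≠ α b := by
    intro a b ha hb hbC hab
    by_cases haC : a ∈ comp G x y z
    · by_cases hby : b = y
      · subst hby; exact hin a ha haC (.inl hab)
      by_cases hbz : b = z
      · subst hbz; rw [← hyz]; exact hin a ha haC (.inr hab)
      exact absurd (comp_adj haC hab hby hbz) hbC
    · rw [hoff a ha haC]; exact hα a b hab
  obtain ⟨β, hβ, hβf⟩ := exists_proper_extend hdeg (comp G x y z \ P)
    (f := fun v => if v ∈ P then h v else α v) (by
      intro a b ha hb hab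
      simp only [Finset.mem_sdiff, not_and_or, not_not] at ha hb
      by_cases haP : a ∈ P <;> by_cases hbP : b ∈ P
      · simpa [haP, hbP] using hP a haP b hbP hab
      · simpa [haP, hbP] using key a b haP hbP (hb.resolve_right hbP) hab
      · simpa [haP, hbP] using (key b a hbP haP (ha.resolve_right haP) hab.symm).symm
      · simpa [haP, hbP] using hα a b hab)
  have hoff' : ∀ v, v ∉ comp G x y z → β v = α v := by
    intro v hv
    rw [hβf v (by simp [hv])]
    by_cases hvP : v ∈ P
    · simp [hvP, hoff v hvP hv]
    · simp [hvP]
  refine ⟨β, hβ, reach_of_eq_off_comp hdeg hc hα hβ hyz hoff', hoff', fun p hp => ?_⟩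
  rw [hβf p (by simp [hp])]
  simp [hp]

/-- If `y` and `q` are the only exits of `D` and have the same colour, then `D` can be coloured
with `d` at `z`, so that no neighbour of `y` has colour `d`. -/
theorem exists_proper_avoiding {G : SimpleGraph V} (hreg : ∀ v, (nbhd G v).card + 1 = k)
    {α : V → Fin k} (hα : Proper G α) {x y q z : V} {D : Finset V} (hyq : α y = α q)
    (hyD : y ∉ D) (hqD : q ∉ D) (hD : ∀ v ∈ D, ∀ w, G.Adj v w → w ∈ D ∨ w = y ∨ w = q)
    (hzD : z ∈ D) (hyz : ¬ G.Adj y z) (hne : y ≠ q) (hxy : G.Adj x y) (hxz : G.Adj x z) {d : Fin k}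
    (hd : d ≠ α y) (hdD : ∀ w, G.Adj y w → w ∉ D → α w ≠ d) :
    ∃ β, Proper G β ∧ (∀ v, v ∉ D → β v = α v) ∧ β z = d ∧ ∀ w, G.Adj y w → β w ≠ d := by
  set U := D.erase z with hUdef
  set f := update α z d with hfdef
  -- `F u` collects the forbidden colours: those of the neighbours already coloured, and `d` if `u`
  -- is adjacent to `y`.
  set F : V → Finset (Fin k) := fun u =>
    (nbhd G u \ U).image f ∪ (if G.Adj u y then {d} else ∅) with hF
  have hzU : z ∉ U := by simp [U]
  have hyz' : y ≠ z := fun e => hyD (e ▸ hzD)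
  have hqz' : q ≠ z := fun e => hqD (e ▸ hzD)
  have hyU : y ∉ U := by simp [U, hyD]
  have hqU : q ∉ U := by simp [U, hqD]
  have hfy : f y = α y := by simp [f, hyz']
  have hfq : f q = α y := by simp [f, hqz', hyq]
  have hUnb : ∀ u ∈ U, ∀ w, G.Adj u w → w ∉ U → w = z ∨ w = y ∨ w = q := by
    intro u hu w huw hw
    rcases hD u (Finset.mem_of_mem_erase hu) w huw with h | h
    · left; by_contra hwz; exact hw (Finset.mem_erase.2 ⟨hwz, h⟩)
    · exact .inr h
  have hF1 : ∀ u, (F u).card ≤ (nbhd G u \ U).card + 1 := by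
    intro u
    refine (Finset.card_union_le _ _).trans (add_le_add Finset.card_image_le ?_)
    split_ifs <;> simp
  -- Forbidding `d` costs nothing if `u` is not adjacent to `y`, if `z` already forbids it, or if
  -- `u` sees both `y` and `q`, whose common colour offsets it.
  have hF0 : ∀ u ∈ U, ¬ (G.Adj u y ∧ ¬ G.Adj u z ∧ ¬ G.Adj u q) →
      (F u).card ≤ (nbhd G u \ U).card := by
    intro u hu hn
    by_cases huy : G.Adj u y
    · by_cases huz : G.Adj u z
      · have : F u = (nbhd G u \ U).image f := by
          simp only [F, huy, if_true]
          refine Finset.union_eq_left.2 (Finset.singleton_subset_iff.2 (Finset.mem_image.2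
            ⟨z, by simp [huz, hzU], by simp [f]⟩))
        rw [this]; exact Finset.card_image_le
      · have huq : G.Adj u q := by tauto
        have h1 : F u ⊆ {α y, d} := by
          intro c hc
          simp only [F, huy, if_true, Finset.mem_union, Finset.mem_image, Finset.mem_sdiff,
            mem_nbhd, Finset.mem_singleton] at hc
          rcases hc with ⟨w, ⟨huw, hw⟩, rfl⟩ | rfl
          · rcases hUnb u hu w huw hw with rfl | rfl | rfl
            · exact absurd huw huz
            · simp [hfy]
            · simp [hfq]
          · simp
        have h2 : ({y, q} : Finset V) ⊆ nbhd G u \ U := by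
          intro w hw
          simp only [Finset.mem_insert, Finset.mem_singleton] at hw
          rcases hw with rfl | rfl
          · simp [huy, hyU]
          · simp [huq, hqU]
        calc (F u).card ≤ _ := Finset.card_le_card h1
          _ ≤ 2 := Finset.card_le_two
          _ = ({y, q} : Finset V).card := (Finset.card_pair hne).symm
          _ ≤ _ := Finset.card_le_card h2
    · simp only [F, huy, if_false, Finset.union_empty]
      exact Finset.card_image_le
  obtain ⟨β, hβf, hβ⟩ := exists_valid_of_degenerate (G := G) (L := fun u => (F u)ᶜ) U
    (fun W hW hWne => by
      simp only [Finset.card_compl, Fintype.card_fin]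
      by_cases hA : ∃ s ∈ W, ¬ (G.Adj s y ∧ ¬ G.Adj s z ∧ ¬ G.Adj s q)
      · obtain ⟨s, hs, h⟩ := hA
        have h1 := hF0 s (hW hs) h
        have h2 := card_inter_add_sdiff_le (G := G) hW s
        have := hreg s
        exact ⟨s, hs, by omega⟩
      push Not at hA
      by_cases hB : ∃ s ∈ W, ∃ t ∈ U, t ∉ W ∧ G.Adj s t
      · obtain ⟨s, hs, t, ht, htW, hst⟩ := hB
        have h1 := hF1 s
        have h2 := card_inter_add_sdiff_lt (G := G) hW ht htW hst
        have := hreg s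
        exact ⟨s, hs, by omega⟩
      push Not at hB
      -- Otherwise `W` consists of costly vertices without neighbours in the rest of `U`. A vertex
      -- `s` of `W` then has all its `k - 1` neighbours in `W` or equal to `y`, so `k - 1 ≤ |W|`.
      -- But `y` is adjacent to all of `W` and also to `x ∉ W`, so `|W| + 1 ≤ k - 1`.
      exfalso
      obtain ⟨s, hs⟩ := hWne
      have h1 : nbhd G s ⊆ insert y (W.erase s) := by
        intro t ht
        rw [mem_nbhd] at ht
        by_cases htU : t ∈ U
        · refine Finset.mem_insert_of_mem (Finset.mem_erase.2 ⟨ht.ne', ?_⟩)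
          by_contra htW
          exact hB s hs t htU htW ht
        · rcases hUnb s (hW hs) t ht htU with rfl | rfl | rfl
          · exact absurd ht (hA s hs).2.1
          · simp
          · exact absurd ht (hA s hs).2.2
      have h2 : insert x W ⊆ nbhd G y := by
        intro t ht
        rcases Finset.mem_insert.1 ht with rfl | ht
        · simpa using hxy.symm
        · simpa using (hA t ht).1.symm
      have hxW : x ∉ W := fun h => (hA x h).2.1 hxz
      have h3 := Finset.card_le_card h1
      have h4 := Finset.card_le_card h2
      rw [Finset.card_insert_of_notMem hxW] at h4
      have h5 := Finset.card_insert_le y (W.erase s)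
      rw [Finset.card_erase_of_mem hs] at h5
      have := Finset.card_pos.2 ⟨s, hs⟩
      have := hreg s
      have := hreg y
      omega) f
  have hval : Valid G U (residualList G U f) β := fun u hu => ⟨by
      have := (hβ u hu).1
      simp only [F, Finset.mem_compl, Finset.mem_union, not_or] at this
      exact Finset.mem_compl.2 this.1, (hβ u hu).2⟩
  have hoff : ∀ v, v ∉ D → β v = α v := fun v hv => by
    rw [hβf v (by simp [U, hv])]
    exact update_of_ne (by rintro rfl; exact hv hzD) _ _
  have hzz : ∀ b, b ∉ U → G.Adj z b → f b ≠ d := by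
    intro b hb hzb
    have hbz : b ≠ z := hzb.ne'
    rcases hD z hzD b hzb with h | rfl | rfl
    · exact absurd (Finset.mem_erase.2 ⟨hbz, h⟩) hb
    · exact absurd hzb.symm hyz
    · rw [hfq]; exact hd.symm
  refine ⟨β, hval.proper ?_ hβf, hoff, by rw [hβf z hzU]; simp [f], ?_⟩
  · intro a b ha hb hab
    by_cases haz : a = z
    · subst haz
      simpa [f] using (hzz b hb hab).symm
    by_cases hbz : b = z
    · subst hbz
      simpa [f] using hzz a ha hab.symm
    simpa [f, haz, hbz] using hα a b hab
  · intro w hyw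
    by_cases hwU : w ∈ U
    · have := (hβ w hwU).1
      simp only [F, hyw.symm, if_true, Finset.mem_compl, Finset.mem_union, not_or,
        Finset.mem_singleton] at this
      exact this.2
    · have hwz : w ≠ z := by rintro rfl; exact hyz hyw
      have hwD : w ∉ D := fun h => hwU (Finset.mem_erase.2 ⟨hwz, h⟩)
      rw [hoff w hwD]
      exact hdD w hyw hwD

end Reachability

/-! ### Free vertices and monochromatic cherries. -/

section Freeness

open scoped Classical
open Function Relation

variable {V : Type*} {k : ℕ}

/-- Some colour does not appear in the closed neighbourhood of `v`. -/
def Free (G : SimpleGraph V) (α : V → Fin k) (v : V) : Prop :=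
  ∃ c, ∀ u, u = v ∨ G.Adj v u → α u ≠ c

theorem Proper.step_update {G : SimpleGraph V} {α : V → Fin k} (hα : Proper G α) {v : V} {c : Fin k}
    (hc : ∀ w, G.Adj v w → α w ≠ c) : Step G α (update α v c) := by
  refine ⟨hα, fun a b hab => ?_, v, c, rfl⟩
  by_cases ha : a = v
  · subst ha
    simpa [hab.ne'] using (hc b hab).symm
  by_cases hb : b = v
  · subst hb
    simpa [ha] using hc a hab.symm
  · simpa [ha, hb] using hα a b hab

theorem exists_colour_notMem {s : Finset (Fin k)} (hs : s.card < k) : ∃ c, c ∉ s := by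
  by_contra! h
  have := Finset.card_le_card (fun c _ => h c : Finset.univ ⊆ s)
  simp at this
  omega

variable [Fintype V]

/-- In the closed neighbourhood of a vertex that is not free, no colour is repeated. -/
theorem eq_of_not_free {G : SimpleGraph V} (hdeg : ∀ v, (nbhd G v).card + 1 ≤ k) {α : V → Fin k}
    {v : V} (hv : ¬ Free G α v) {a b : V} (ha : a = v ∨ G.Adj v a) (hb : b = v ∨ G.Adj v b)
    (hab : α a = α b) : a = b := by
  simp only [Free, not_exists, not_forall, not_not] at hv
  have hsurj : (insert v (nbhd G v)).image α = Finset.univ := by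
    refine Finset.eq_univ_of_forall fun c => ?_
    obtain ⟨u, hu, rfl⟩ := hv c
    exact Finset.mem_image_of_mem _ (by simpa using hu)
  have hcard : ((insert v (nbhd G v)).image α).card = (insert v (nbhd G v)).card := by
    refine le_antisymm Finset.card_image_le ?_
    rw [hsurj, Finset.card_univ, Fintype.card_fin]
    exact (Finset.card_insert_le _ _).trans (hdeg v)
  exact Finset.card_image_iff.1 hcard (by simpa using ha) (by simpa using hb) hab

/-- Recolouring a free vertex frees its neighbours that were not free. -/
theorem exists_reach_free {G : SimpleGraph V} (hG : G.Preconnected)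
    (hdeg : ∀ v, (nbhd G v).card + 1 ≤ k) {α : V → Fin k} (hα : Proper G α) {v : V}
    (hv : Free G α v) (x : V) : ∃ β, Proper G β ∧ Reach G α β ∧ Free G β x := by
  have hp := (SimpleGraph.reachable_iff_reflTransGen v x).1 (hG v x)
  induction hp using ReflTransGen.head_induction_on generalizing α with
  | refl => exact ⟨α, hα, .refl, hv⟩
  | @head v v₁ hadj _ ih =>
    by_cases h₁ : Free G α v₁
    · exact ih hα h₁
    obtain ⟨c, hc⟩ := hv
    have hs := hα.step_update (v := v) (c := c) fun w hw => hc w (.inr hw)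
    -- As `v₁` is not free, `v` is the only vertex of its closed neighbourhood coloured `α v`.
    -- Recolouring `v` makes that colour missing at `v₁`.
    obtain ⟨β, hβ, hr, hf⟩ := ih hs.2.1 ⟨α v, fun u hu => by
      by_cases huv : u = v
      · subst huv
        simpa using (hc u (.inl rfl)).symm
      · rw [update_of_ne huv]
        exact fun e => huv (eq_of_not_free hdeg h₁ hu (.inr hadj.symm) e)⟩
    exact ⟨β, hβ, .head hs hr, hf⟩

/-- Pigeonhole: the `k - 1` neighbours of `x` avoid both the missing colour and the colour of `x`.
Two neighbours of equal colour are nonadjacent. -/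
theorem Free.exists_cherry {G : SimpleGraph V} (hreg : ∀ v, (nbhd G v).card + 1 = k)
    {α : V → Fin k} (hα : Proper G α) {x : V} (hx : Free G α x) :
    ∃ p q, IsCherry G x p q ∧ α p = α q := by
  obtain ⟨c, hc⟩ := hx
  have hcx : c ≠ α x := (hc x (.inl rfl)).symm
  obtain ⟨p, hp, q, hq, hpq, he⟩ := Finset.exists_ne_map_eq_of_card_lt_of_maps_to
    (s := nbhd G x) (t := ({c, α x} : Finset (Fin k))ᶜ) (f := α) (by
      rw [Finset.card_compl, Finset.card_pair hcx, Fintype.card_fin]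
      have := hreg x
      have h2 := Finset.card_le_univ ({c, α x} : Finset (Fin k))
      rw [Finset.card_pair hcx, Fintype.card_fin] at h2
      omega) (fun w hw => by
      have hw : G.Adj x w := by simpa using hw
      simpa using ⟨(hα x w hw).symm, hc w (.inr hw)⟩)
  rw [mem_nbhd] at hp hq
  exact ⟨p, q, ⟨hp, hq, hpq, fun h => hα p q h he⟩, he⟩

/-- A monochromatic cherry at `x` can be traded for another one that shares a leaf. -/
theorem exists_reach_shared_leaf {G : SimpleGraph V} (hreg : ∀ v, (nbhd G v).card + 1 = k)
    {x y q z : V} (hq : IsCherry G x y q) (hz : IsCherry G x y z) (hzq : z ≠ q) {α : V → Fin k}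
    (hα : Proper G α) (hyq : α y = α q) : ∃ β, Proper G β ∧ Reach G α β ∧ β y = β z := by
  have hdeg : ∀ v, (nbhd G v).card + 1 ≤ k := fun v => (hreg v).le
  have hx := self_mem_comp G x y q
  have hyD : y ∉ comp G x y q := left_notMem_comp hq.left.ne
  -- Since the neighbour `x` of `y` lies in the component, at most `k - 2` neighbours of `y` lie
  -- outside it. These and `y` itself leave a colour `d`, to be given first to `z` and then to `y`.
  obtain ⟨d, hd⟩ := exists_colour_notMem (k := k)
    (s := insert (α y) ((nbhd G y \ comp G x y q).image α)) (by
      have h1 := Finset.card_insert_le (α y) ((nbhd G y \ comp G x y q).image α)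
      have h2 : ((nbhd G y \ comp G x y q).image α).card ≤ _ := Finset.card_image_le
      have h3 : nbhd G y \ comp G x y q ⊆ (nbhd G y).erase x := by
        intro w hw
        rw [Finset.mem_sdiff] at hw
        exact Finset.mem_erase.2 ⟨by rintro rfl; exact hw.2 hx, hw.1⟩
      have h4 := Finset.card_le_card h3
      have hxy : x ∈ nbhd G y := by simpa using hq.left.symm
      rw [Finset.card_erase_of_mem hxy] at h4
      have := Finset.card_pos.2 ⟨x, hxy⟩
      have := hreg y
      omega)
  simp only [Finset.mem_insert, Finset.mem_image, Finset.mem_sdiff, mem_nbhd, not_or,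
    not_exists, not_and, and_imp] at hd
  obtain ⟨β, hβ, hoff, hβz, hβy⟩ := exists_proper_avoiding hreg hα hyq hyD
    (right_notMem_comp hq.right.ne)
    (fun v hv w hvw => by
      by_contra! h
      exact h.1 (comp_adj hv hvw h.2.1 h.2.2))
    (comp_adj hx hz.right hz.ne.symm hzq) hz.nadj hq.ne hz.left hz.right hd.1 hd.2
  have hs := hβ.step_update (v := y) (c := d) hβy
  exact ⟨_, hs.2.1, (reach_of_eq_off_comp hdeg hq hα hβ hyq hoff).tail hs,
    by simp [hz.ne.symm, hβz]⟩

/-- From a colouring with a free vertex, any cherry can be made monochromatic. -/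
theorem exists_reach_cherry {G : SimpleGraph V} (hG : G.Preconnected) (hk : 2 ≤ k)
    (hreg : ∀ v, (nbhd G v).card + 1 = k) {α : V → Fin k} (hα : Proper G α)
    (hfree : ∃ v, Free G α v) {x y z : V} (hc : IsCherry G x y z) :
    ∃ β, Proper G β ∧ Reach G α β ∧ β y = β z := by
  have hdeg : ∀ v, (nbhd G v).card + 1 ≤ k := fun v => (hreg v).le
  obtain ⟨v, hv⟩ := hfree
  obtain ⟨β, hβ, hr, hx⟩ := exists_reach_free hG hdeg hα hv x
  suffices ∃ γ, Proper G γ ∧ Reach G β γ ∧ γ y = γ z by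
    obtain ⟨γ, h1, h2, h3⟩ := this
    exact ⟨γ, h1, hr.trans h2, h3⟩
  obtain ⟨p, q, hpq, he⟩ := hx.exists_cherry hreg hβ
  by_cases h1 : p = y
  · subst h1
    by_cases h2 : z = q
    · subst h2; exact ⟨β, hβ, .refl, he⟩
    · exact exists_reach_shared_leaf hreg hpq hc h2 hβ he
  by_cases h2 : q = y
  · subst h2
    by_cases h3 : z = p
    · subst h3; exact ⟨β, hβ, .refl, he.symm⟩
    · exact exists_reach_shared_leaf hreg hpq.symm hc h3 hβ he.symm
  by_cases h3 : p = z
  · subst h3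
    obtain ⟨γ, a, b, c⟩ := exists_reach_shared_leaf hreg hpq hc.symm (Ne.symm h2) hβ he
    exact ⟨γ, a, b, c.symm⟩
  by_cases h4 : q = z
  · subst h4
    obtain ⟨γ, a, b, c⟩ := exists_reach_shared_leaf hreg hpq.symm hc.symm (Ne.symm h1) hβ he.symm
    exact ⟨γ, a, b, c.symm⟩
  -- With disjoint leaf pairs, `y` and `z` lie in the component of `x` without `p` and `q`, so both
  -- can be given the same colour `c`.
  obtain ⟨c, hc'⟩ := exists_colour_notMem (s := {β p}) (by simp; omega)
  have hx := self_mem_comp G x p q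
  obtain ⟨γ, a, b, -, d⟩ := exists_reach_prescribed hdeg hpq hβ he {y, z} (fun _ => c)
    (by
      intro a ha b hb hab
      simp only [Finset.mem_insert, Finset.mem_singleton] at ha hb
      rcases ha with rfl | rfl <;> rcases hb with rfl | rfl
      · exact absurd hab (G.loopless.irrefl _)
      · exact absurd hab hc.nadj
      · exact absurd hab.symm hc.nadj
      · exact absurd hab (G.loopless.irrefl _))
    (by
      intro a ha hn
      simp only [Finset.mem_insert, Finset.mem_singleton] at ha
      rcases ha with rfl | rfl
      · exact absurd (comp_adj hx hc.left (Ne.symm h1) (Ne.symm h2)) hn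
      · exact absurd (comp_adj hx hc.right (Ne.symm h3) (Ne.symm h4)) hn)
    (fun _ _ _ _ => by simpa using hc')
  exact ⟨γ, a, b, by rw [d y (by simp), d z (by simp)]⟩

/-- The components of the centres of several monochromatic cherries can be recoloured in turn. -/
theorem exists_reach_mixed {G : SimpleGraph V} (hdeg : ∀ v, (nbhd G v).card + 1 ≤ k)
    (l : List (V × V × V)) (hl : ∀ e ∈ l, IsCherry G e.1 e.2.1 e.2.2) {α β : V → Fin k}
    (hα : Proper G α) (hβ : Proper G β) (hmono : ∀ e ∈ l, β e.2.1 = β e.2.2)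
    (hαβ : ∀ e ∈ l, α e.2.1 = β e.2.1 ∧ α e.2.2 = β e.2.2) :
    ∃ γ, Proper G γ ∧ Reach G α γ ∧ (∀ v, γ v = α v ∨ γ v = β v) ∧
      ∀ e ∈ l, ∀ v ∈ comp G e.1 e.2.1 e.2.2, γ v = β v := by
  induction l generalizing α with
  | nil => exact ⟨α, hα, .refl, fun _ => .inl rfl, by simp⟩
  | cons e l ih =>
    simp only [List.forall_mem_cons] at hl hmono hαβ
    set C := comp G e.1 e.2.1 e.2.2 with hC
    -- The only exits of `C` are the two leaves, where `α` and `β` agree. Replacing `α` by `β` on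
    -- `C` thus stays proper.
    have key : ∀ a b, a ∈ C → b ∉ C → G.Adj a b → β a ≠ α b := by
      intro a b ha hb hab
      have : α b = β b := by
        by_cases h1 : b = e.2.1
        · rw [h1]; exact hαβ.1.1
        by_cases h2 : b = e.2.2
        · rw [h2]; exact hαβ.1.2
        exact absurd (comp_adj ha hab h1 h2) hb
      rw [this]
      exact hβ a b hab
    set α₁ : V → Fin k := fun v => if v ∈ C then β v else α v with hα₁
    have hp : Proper G α₁ := by
      intro a b hab
      by_cases ha : a ∈ C <;> by_cases hb : b ∈ C
      · simpa [α₁, ha, hb] using hβ a b hab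
      · simpa [α₁, ha, hb] using key a b ha hb hab
      · simpa [α₁, ha, hb] using (key b a hb ha hab.symm).symm
      · simpa [α₁, ha, hb] using hα a b hab
    have hr : Reach G α α₁ := reach_of_eq_off_comp hdeg hl.1 hα hp
      (by rw [hαβ.1.1, hαβ.1.2]; exact hmono.1) (fun v hv => if_neg hv)
    have hor : ∀ v, α₁ v = α v ∨ α₁ v = β v := by
      intro v
      by_cases hv : v ∈ C <;> simp [α₁, hv]
    obtain ⟨γ, h1, h2, h3, h4⟩ := ih hl.2 hp hmono.2 (fun e' he' => by
      have := hαβ.2 e' he'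
      constructor
      · rcases hor e'.2.1 with h | h <;> rw [h]; exact this.1
      · rcases hor e'.2.2 with h | h <;> rw [h]; exact this.2)
    refine ⟨γ, h1, hr.trans h2, fun v => ?_, ?_⟩
    · rcases h3 v with h | h
      · rw [h]; exact hor v
      · exact .inr h
    · simp only [List.forall_mem_cons]
      refine ⟨fun v hv => ?_, h4⟩
      rcases h3 v with h | h
      · rw [h]; exact if_pos hv
      · exact h

/-- If each leaf of each cherry lies in the component of the centre of another one, colourings
that agree on the leaves, where the cherries are monochromatic, are connected. -/
theorem reach_of_cover {G : SimpleGraph V} (hG : G.Preconnected)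
    (hdeg : ∀ v, (nbhd G v).card + 1 ≤ k)
    (l : List (V × V × V)) (hne : l ≠ []) (hl : ∀ e ∈ l, IsCherry G e.1 e.2.1 e.2.2)
    (hcov : ∀ e ∈ l, (∃ e' ∈ l, e.2.1 ∈ comp G e'.1 e'.2.1 e'.2.2) ∧
      ∃ e' ∈ l, e.2.2 ∈ comp G e'.1 e'.2.1 e'.2.2) {α β : V → Fin k}
    (hα : Proper G α) (hβ : Proper G β) (hmono : ∀ e ∈ l, β e.2.1 = β e.2.2)
    (hαβ : ∀ e ∈ l, α e.2.1 = β e.2.1 ∧ α e.2.2 = β e.2.2) : Reach G α β := by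
  obtain ⟨γ, -, hr, -, hγ⟩ := exists_reach_mixed hdeg l hl hα hβ hmono hαβ
  suffices γ = β from this ▸ hr
  funext v
  obtain ⟨e₀, he₀⟩ := List.exists_mem_of_ne_nil l hne
  -- The union of the components is closed under adjacency: an edge leaves a component only to one
  -- of its leaves, which lies in another component. By connectivity the union is everything.
  obtain ⟨e, he, hv⟩ := mem_of_closed hG (S := fun v => ∃ e ∈ l, v ∈ comp G e.1 e.2.1 e.2.2)
    ⟨e₀, he₀, self_mem_comp G _ _ _⟩ (fun u w ⟨e, he, hu⟩ huw => by
      by_cases h1 : w = e.2.1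
      · rw [h1]; exact (hcov e he).1
      by_cases h2 : w = e.2.2
      · rw [h2]; exact (hcov e he).2
      exact ⟨e, he, comp_adj hu huw h1 h2⟩) v
  exact hγ e he v hv

/-- Recolouring the two leaves of a cherry, by means of another monochromatic cherry. -/
theorem exists_reach_recolour_pair {G : SimpleGraph V} (hdeg : ∀ v, (nbhd G v).card + 1 ≤ k)
    {x y z p q : V} (hc : IsCherry G x y z) (hpq : ¬ G.Adj p q) (hp : p ∈ comp G x y z)
    (hq : q ∈ comp G x y z) {α : V → Fin k} (hα : Proper G α) (hyz : α y = α z) {c : Fin k}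
    (hcy : c ≠ α y) : ∃ β, Proper G β ∧ Reach G α β ∧ (∀ v, v ∉ comp G x y z → β v = α v) ∧
      β p = c ∧ β q = c := by
  obtain ⟨β, h1, h2, h3, h4⟩ := exists_reach_prescribed hdeg hc hα hyz {p, q} (fun _ => c)
    (by
      intro a ha b hb hab
      simp only [Finset.mem_insert, Finset.mem_singleton] at ha hb
      rcases ha with rfl | rfl <;> rcases hb with rfl | rfl
      · exact absurd hab (G.loopless.irrefl _)
      · exact absurd hab hpq
      · exact absurd hab.symm hpq
      · exact absurd hab (G.loopless.irrefl _))
    (by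
      intro a ha hn
      simp only [Finset.mem_insert, Finset.mem_singleton] at ha
      rcases ha with rfl | rfl
      · exact absurd hp hn
      · exact absurd hq hn)
    (fun _ _ _ _ => hcy)
  exact ⟨β, h1, h2, h3, h4 p (by simp), h4 q (by simp)⟩

/-- Each cherry, while monochromatic, allows the leaves of the other to be recoloured. Every
colouring with a free vertex is thus brought to `a` on `y, z` and `b` on `y', z'`, and
`reach_of_cover` applies. -/
theorem reach_of_two_cherries {G : SimpleGraph V} (hG : G.Preconnected) (hk : 4 ≤ k)
    (hreg : ∀ v, (nbhd G v).card + 1 = k) {x y z x' y' z' : V} (hc : IsCherry G x y z)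
    (hc' : IsCherry G x' y' z') (hy : y ∈ comp G x' y' z') (hz : z ∈ comp G x' y' z')
    (hy' : y' ∈ comp G x y z) (hz' : z' ∈ comp G x y z) {α β : V → Fin k}
    (hα : Proper G α) (hβ : Proper G β) (hα' : ∃ v, Free G α v) (hβ' : ∃ v, Free G β v) :
    Reach G α β := by
  have hdeg : ∀ v, (nbhd G v).card + 1 ≤ k := fun v => (hreg v).le
  have hyn : y ∉ comp G x y z := left_notMem_comp hc.left.ne
  have hzn : z ∉ comp G x y z := right_notMem_comp hc.right.ne
  have hyn' : y' ∉ comp G x' y' z' := left_notMem_comp hc'.left.ne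
  have hzn' : z' ∉ comp G x' y' z' := right_notMem_comp hc'.right.ne
  obtain ⟨a, -⟩ := exists_colour_notMem (k := k) (s := ∅) (by simp; omega)
  obtain ⟨b, hb⟩ := exists_colour_notMem (k := k) (s := {a}) (by simp; omega)
  rw [Finset.mem_singleton] at hb
  have key : ∀ α : V → Fin k, Proper G α → (∃ v, Free G α v) → ∃ γ, Proper G γ ∧ Reach G α γ ∧
      γ y = a ∧ γ z = a ∧ γ y' = b ∧ γ z' = b := by
    intro α hα hα'
    obtain ⟨α₁, h1, r1, e1⟩ := exists_reach_cherry hG (by omega) hreg hα hα' hc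
    -- The intermediate colour `c` on `y', z'` must differ from the present colour of `y, z` and
    -- from their target `a`.
    obtain ⟨c, hcc⟩ := exists_colour_notMem (k := k) (s := {α₁ y, a})
      (lt_of_le_of_lt Finset.card_le_two (by omega))
    simp only [Finset.mem_insert, Finset.mem_singleton, not_or] at hcc
    obtain ⟨α₂, h2, r2, o2, e2, e2'⟩ :=
      exists_reach_recolour_pair hdeg hc hc'.nadj hy' hz' h1 e1 hcc.1
    obtain ⟨α₃, h3, r3, o3, e3, e3'⟩ := exists_reach_recolour_pair hdeg hc' hc.nadj hy hz h2
      (e2.trans e2'.symm) (c := a) (by rw [e2]; exact Ne.symm hcc.2)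
    obtain ⟨α₄, h4, r4, o4, e4, e4'⟩ := exists_reach_recolour_pair hdeg hc hc'.nadj hy' hz' h3
      (e3.trans e3'.symm) (c := b) (by rw [e3]; exact hb)
    exact ⟨α₄, h4, ((r1.trans r2).trans r3).trans r4, by rw [o4 y hyn, e3], by rw [o4 z hzn, e3'],
      e4, e4'⟩
  obtain ⟨γ, g1, g2, g3, g4, g5, g6⟩ := key α hα hα'
  obtain ⟨δ, d1, d2, d3, d4, d5, d6⟩ := key β hβ hβ'
  refine g2.trans (Reach.trans ?_ d2.symm)
  refine reach_of_cover hG hdeg [(x, y, z), (x', y', z')] (by simp) (by simp [hc, hc']) ?_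
    g1 d1 (by simp [d3, d4, d5, d6]) (by simp [*])
  simp [hy, hz, hy', hz']

end Freeness

/-! ### Induced claws and nets. -/

section Brooks

open scoped Classical
open Function Relation

variable {V : Type*} [Fintype V] {k : ℕ}

/-- All colourings with a free vertex are connected if `G` has an induced claw. -/
theorem reach_of_claw {G : SimpleGraph V} (hG : G.Preconnected) (hk : 4 ≤ k)
    (hreg : ∀ v, (nbhd G v).card + 1 = k) {x y z q : V} (hyz : IsCherry G x y z)
    (hyq : IsCherry G x y q) (hzq : IsCherry G x z q) {α β : V → Fin k}
    (hα : Proper G α) (hβ : Proper G β) (hα' : ∃ v, Free G α v) (hβ' : ∃ v, Free G β v) :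
    Reach G α β := by
  have hdeg : ∀ v, (nbhd G v).card + 1 ≤ k := fun v => (hreg v).le
  have hq : q ∈ comp G x y z :=
    comp_adj (self_mem_comp G x y z) hyq.right hyq.ne.symm hzq.ne.symm
  have hz : z ∈ comp G x y q :=
    comp_adj (self_mem_comp G x y q) hyz.right hyz.ne.symm hzq.ne
  have hy : y ∈ comp G x z q :=
    comp_adj (self_mem_comp G x z q) hyz.left hyz.ne hyq.ne
  obtain ⟨a, -⟩ := exists_colour_notMem (k := k) (s := ∅) (by simp; omega)
  have same : ∀ γ δ : V → Fin k, Proper G γ → Proper G δ → γ z = γ y → γ q = γ y → δ y = γ y →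
      δ z = γ y → δ q = γ y → Reach G γ δ := by
    intro γ δ hγ hδ h1 h2 h3 h4 h5
    exact reach_of_cover hG hdeg [(x, y, z), (x, y, q), (x, z, q)] (by simp)
      (by simp [hyz, hyq, hzq]) (by simp [hq, hz, hy]) hγ hδ (by simp [*]) (by simp [*])
  have key : ∀ α : V → Fin k, Proper G α → (∃ v, Free G α v) → ∃ γ, Proper G γ ∧ Reach G α γ ∧
      γ y = a ∧ γ z = a ∧ γ q = a := by
    intro α hα hα'
    obtain ⟨α₁, h1, r1, e1⟩ := exists_reach_cherry hG (by omega) hreg hα hα' hyz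
    obtain ⟨α₂, h2, r2, o2, e2⟩ := exists_reach_prescribed hdeg hyz h1 e1 {q} (fun _ => α₁ y)
      (by simp) (by simp [hq])
      (by
        intro p hp _ h
        simp only [Finset.mem_singleton] at hp
        subst hp
        exact absurd h (not_or.2 ⟨fun h => hyq.nadj h.symm, fun h => hzq.nadj h.symm⟩))
    simp only [Finset.mem_singleton, forall_eq] at e2
    have ey : α₂ y = α₁ y := o2 y (left_notMem_comp hyz.left.ne)
    have ez : α₂ z = α₁ y := (o2 z (right_notMem_comp hyz.right.ne)).trans e1.symm
    by_cases hca : a = α₁ y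
    · exact ⟨α₂, h2, r1.trans r2, by rw [ey, hca], by rw [ez, hca], by rw [e2, hca]⟩
    -- To change the common colour of the leaves to `a`, a bridge `ψ` is used: `z` and `q` keep the
    -- old colour, `y` has colour `a`, and `z` may be recoloured with `a`. From `ψ` one way leads to
    -- `ψ₁`, with all leaves in the old colour, and the other to `ψ₂`, with all leaves in colour
    -- `a`.
    obtain ⟨ψ, hψ, oψ, eψ, nψ⟩ := exists_proper_avoiding hreg h2 (x := x) (y := z) (q := q) (z := y)
      (D := {z, q}ᶜ) (d := a) (by rw [ez, e2]) (by simp) (by simp)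
      (by
        intro v _ w _
        simp only [Finset.mem_compl, Finset.mem_insert, Finset.mem_singleton]
        tauto)
      (by simp [hyz.ne, hyq.ne]) (fun h => hyz.nadj h.symm) hzq.ne hyz.right hyz.left
      (by rw [ez]; exact hca)
      (by
        intro w hzw hw
        simp only [Finset.mem_compl, Finset.mem_insert, Finset.mem_singleton, not_not] at hw
        rcases hw with rfl | rfl
        · exact absurd hzw (G.loopless.irrefl _)
        · exact absurd hzw hzq.nadj)
    have ψz : ψ z = α₁ y := by rw [oψ z (by simp), ez]
    have ψq : ψ q = α₁ y := by rw [oψ q (by simp), e2]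
    obtain ⟨ψ₁, p1, s1, t1, u1⟩ := exists_reach_prescribed hdeg hzq hψ (ψz.trans ψq.symm) {y}
      (fun _ => α₁ y) (by simp) (by simp [hy])
      (by
        intro p hp _ h
        simp only [Finset.mem_singleton] at hp
        subst hp
        exact absurd h (not_or.2 ⟨hyz.nadj, hyq.nadj⟩))
    simp only [Finset.mem_singleton, forall_eq] at u1
    have hs := hψ.step_update nψ
    obtain ⟨ψ₂, p2, s2, t2, u2⟩ := exists_reach_prescribed hdeg hyz hs.2.1
      (by simp [hyz.ne, eψ]) {q} (fun _ => a) (by simp) (by simp [hq])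
      (by
        intro p hp _ h
        simp only [Finset.mem_singleton] at hp
        subst hp
        exact absurd h (not_or.2 ⟨fun h => hyq.nadj h.symm, fun h => hzq.nadj h.symm⟩))
    simp only [Finset.mem_singleton, forall_eq] at u2
    -- `ψ` itself need not be visibly reachable from `α₂`; `same` links `α₂` to `ψ₁`, whence `ψ` is
    -- reached by reversing.
    have r3 : Reach G α₂ ψ₁ := same _ _ h2 p1 (by rw [ez, ey]) (by rw [e2, ey]) (by rw [u1, ey])
      (by rw [t1 z (left_notMem_comp hzq.left.ne), ψz, ey])
      (by rw [t1 q (right_notMem_comp hzq.right.ne), ψq, ey])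
    refine ⟨ψ₂, p2, ((r1.trans r2).trans (r3.trans s1.symm)).trans (.head hs s2), ?_, ?_, u2⟩
    · rw [t2 y (left_notMem_comp hyz.left.ne), update_of_ne hyz.ne, eψ]
    · rw [t2 z (right_notMem_comp hyz.right.ne), update_self]
  obtain ⟨γ, g1, g2, g3, g4, g5⟩ := key α hα hα'
  obtain ⟨δ, d1, d2, d3, d4, d5⟩ := key β hβ hβ'
  exact g2.trans ((same γ δ g1 d1 (by rw [g4, g3]) (by rw [g5, g3]) (by rw [d3, g3])
    (by rw [d4, g3]) (by rw [d5, g3])).trans d2.symm)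

/-- A triangle with a pendant edge at each of its vertices; the ends of these edges may be
adjacent to each other. -/
structure IsNet (G : SimpleGraph V) (q₁ q₂ q₃ o₁ o₂ o₃ : V) : Prop where
  q₁₂ : G.Adj q₁ q₂
  q₂₃ : G.Adj q₂ q₃
  q₃₁ : G.Adj q₃ q₁
  e₁ : G.Adj q₁ o₁
  e₂ : G.Adj q₂ o₂
  e₃ : G.Adj q₃ o₃
  n₁₂ : ¬ G.Adj o₁ q₂
  n₁₃ : ¬ G.Adj o₁ q₃
  n₂₁ : ¬ G.Adj o₂ q₁
  n₂₃ : ¬ G.Adj o₂ q₃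
  n₃₁ : ¬ G.Adj o₃ q₁
  n₃₂ : ¬ G.Adj o₃ q₂
  o₁₂ : o₁ ≠ o₂
  o₂₃ : o₂ ≠ o₃
  o₃₁ : o₃ ≠ o₁

variable {G : SimpleGraph V} {q₁ q₂ q₃ o₁ o₂ o₃ : V}

omit [Fintype V] in
theorem IsNet.rotate (h : IsNet G q₁ q₂ q₃ o₁ o₂ o₃) : IsNet G q₂ q₃ q₁ o₂ o₃ o₁ :=
  ⟨h.q₂₃, h.q₃₁, h.q₁₂, h.e₂, h.e₃, h.e₁, h.n₂₃, h.n₂₁, h.n₃₂, h.n₃₁, h.n₁₂, h.n₁₃, h.o₂₃, h.o₃₁,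
    h.o₁₂⟩

omit [Fintype V] in
theorem IsNet.ne₁₂ (h : IsNet G q₁ q₂ q₃ o₁ o₂ o₃) : o₁ ≠ q₂ := by
  rintro rfl; exact h.n₁₃ h.q₂₃

omit [Fintype V] in
theorem IsNet.ne₂₁ (h : IsNet G q₁ q₂ q₃ o₁ o₂ o₃) : o₂ ≠ q₁ := by
  rintro rfl; exact h.n₂₃ h.q₃₁.symm

omit [Fintype V] in
theorem IsNet.cherry (h : IsNet G q₁ q₂ q₃ o₁ o₂ o₃) : IsCherry G q₁ o₁ q₂ :=
  ⟨h.e₁, h.q₁₂, h.ne₁₂, h.n₁₂⟩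

theorem IsNet.mem_q₁ (h : IsNet G q₁ q₂ q₃ o₁ o₂ o₃) : q₁ ∈ comp G q₂ o₂ q₃ :=
  comp_adj (self_mem_comp G _ _ _) h.q₁₂.symm h.ne₂₁.symm h.q₃₁.ne.symm

theorem IsNet.mem_o₁ (h : IsNet G q₁ q₂ q₃ o₁ o₂ o₃) : o₁ ∈ comp G q₂ o₂ q₃ :=
  comp_adj h.mem_q₁ h.e₁ h.o₁₂ h.rotate.rotate.ne₂₁

theorem IsNet.mem_q₃ (h : IsNet G q₁ q₂ q₃ o₁ o₂ o₃) : q₃ ∈ comp G q₁ o₁ q₂ :=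
  comp_adj (self_mem_comp G _ _ _) h.q₃₁.symm h.rotate.rotate.ne₂₁.symm h.q₂₃.ne.symm

theorem IsNet.mem_o₃ (h : IsNet G q₁ q₂ q₃ o₁ o₂ o₃) : o₃ ∈ comp G q₁ o₁ q₂ :=
  comp_adj h.mem_q₃ h.e₃ h.o₃₁ h.rotate.ne₂₁

/-- From one monochromatic cherry all three rotations become monochromatic, the first keeping its
colour. The cherry at `q₁` lets `q₁` and `o₃` agree, which makes the cherry at `q₃` monochromatic;
that one in turn lets `o₂` agree with `q₃`. -/
theorem IsNet.exists_reach (h : IsNet G q₁ q₂ q₃ o₁ o₂ o₃)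
    (hdeg : ∀ v, (nbhd G v).card + 1 ≤ k) {α : V → Fin k} (hα : Proper G α) (he : α o₁ = α q₂)
    {a b : Fin k} (ha : a ≠ α o₁) (hb : b ≠ α o₁) (hab : a ≠ b) :
    ∃ β, Proper G β ∧ Reach G α β ∧ β q₁ = a ∧ β o₃ = a ∧ β q₂ = α o₁ ∧ β o₁ = α o₁ ∧
      β q₃ = b ∧ β o₂ = b := by
  have n1 := h.ne₁₂
  have n2 := h.ne₂₁
  have n3 := h.rotate.ne₁₂
  have n4 := h.rotate.ne₂₁
  have n5 := h.rotate.rotate.ne₁₂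
  have n6 := h.rotate.rotate.ne₂₁
  have m1 := h.q₁₂.ne
  have m2 := h.q₂₃.ne
  have m3 := h.q₃₁.ne
  have o1 := h.o₁₂
  have o2 := h.o₂₃
  have o3 := h.o₃₁
  have l1 := h.e₁.ne
  have l2 := h.e₂.ne
  have l3 := h.e₃.ne
  have k1 := h.n₃₁
  have k1' : ¬ G.Adj q₁ o₃ := fun e => k1 e.symm
  have irr : ∀ v, ¬ G.Adj v v := fun v => G.loopless.irrefl v
  set f : V → Fin k := update (update (update α q₁ a) q₃ b) o₃ a with hf
  have f1 : f q₁ = a := by simp [f, n5.symm, m3.symm]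
  have f2 : f q₃ = b := by simp [f, l3]
  have f3 : f o₃ = a := by simp [f]
  obtain ⟨β, h1, r1, b1, b2⟩ := exists_reach_prescribed hdeg h.cherry hα he {q₁, q₃, o₃} f
    (by
      intro p hp q hq hadj
      simp only [Finset.mem_insert, Finset.mem_singleton] at hp hq
      grind)
    (by simp [self_mem_comp, h.mem_q₃, h.mem_o₃])
    (by
      intro p hp _ _
      simp only [Finset.mem_insert, Finset.mem_singleton] at hp
      grind)
  simp only [Finset.mem_insert, Finset.mem_singleton, forall_eq_or_imp, forall_eq] at b2
  obtain ⟨c1, c2, c3⟩ := b2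
  rw [f1] at c1
  rw [f2] at c2
  rw [f3] at c3
  have c4 : β o₁ = α o₁ := b1 _ (left_notMem_comp l1)
  have c5 : β q₂ = α o₁ := (b1 _ (right_notMem_comp m1)).trans he.symm
  have k2 := h.n₁₂
  have k2' : ¬ G.Adj q₂ o₁ := fun e => k2 e.symm
  have k3 := h.n₂₃
  have k3' : ¬ G.Adj q₃ o₂ := fun e => k3 e.symm
  set g : V → Fin k := update β o₂ b with hg
  have g1 : g q₁ = a := by simp [g, n2.symm, c1]
  have g2 : g q₂ = α o₁ := by simp [g, l2, c5]
  have g3 : g q₃ = b := by simp [g, n3.symm, c2]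
  have g4 : g o₁ = α o₁ := by simp [g, o1, c4]
  have g5 : g o₂ = b := by simp [g]
  have g6 : g o₃ = a := by simp [g, o2.symm, c3]
  obtain ⟨γ, h2, r2, d1, d2⟩ := exists_reach_prescribed hdeg h.rotate.rotate.cherry h1
    (c3.trans c1.symm) {q₁, q₂, q₃, o₁, o₂, o₃} g
    (by
      intro p hp q hq hadj
      simp only [Finset.mem_insert, Finset.mem_singleton] at hp hq
      rcases hp with rfl | rfl | rfl | rfl | rfl | rfl <;> grind)
    (by
      intro p hp hn
      have : p ≠ o₂ := by
        rintro rfl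
        exact hn h.rotate.rotate.mem_o₃
      exact update_of_ne this _ _)
    (by
      intro p hp hmem hadj
      have e1 : p ≠ q₁ := by rintro rfl; exact right_notMem_comp m3 hmem
      have e2 : p ≠ o₃ := by rintro rfl; exact left_notMem_comp l3 hmem
      simp only [Finset.mem_insert, Finset.mem_singleton] at hp
      grind)
  simp only [Finset.mem_insert, Finset.mem_singleton, forall_eq_or_imp, forall_eq] at d2
  obtain ⟨x1, x2, x3, x4, x5, x6⟩ := d2
  exact ⟨γ, h2, r1.trans r2, by rw [x1, g1], by rw [x6, g6], by rw [x2, g2], by rw [x4, g4],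
    by rw [x3, g3], by rw [x5, g5]⟩

/-- The normal form has colours `a`, `b`, `c` on the leaf pairs of the three rotated cherries, whose
components cover each other's leaves. -/
theorem reach_of_net (h : IsNet G q₁ q₂ q₃ o₁ o₂ o₃) (hG : G.Preconnected) (hk : 4 ≤ k)
    (hreg : ∀ v, (nbhd G v).card + 1 = k) {α β : V → Fin k}
    (hα : Proper G α) (hβ : Proper G β) (hα' : ∃ v, Free G α v) (hβ' : ∃ v, Free G β v) :
    Reach G α β := by
  have hdeg : ∀ v, (nbhd G v).card + 1 ≤ k := fun v => (hreg v).le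
  obtain ⟨a, -⟩ := exists_colour_notMem (k := k) (s := ∅) (by simp; omega)
  obtain ⟨b, hb⟩ := exists_colour_notMem (k := k) (s := {a}) (by simp; omega)
  obtain ⟨c, hc⟩ := exists_colour_notMem (k := k) (s := {a, b})
    (lt_of_le_of_lt Finset.card_le_two (by omega))
  simp only [Finset.mem_insert, Finset.mem_singleton, not_or] at hb hc
  have key : ∀ α : V → Fin k, Proper G α → (∃ v, Free G α v) → ∃ γ, Proper G γ ∧ Reach G α γ ∧
      γ q₁ = a ∧ γ o₃ = a ∧ γ q₂ = b ∧ γ o₁ = b ∧ γ q₃ = c ∧ γ o₂ = c := by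
    intro α hα hα'
    obtain ⟨α₁, h1, r1, e1⟩ := exists_reach_cherry hG (by omega) hreg hα hα' h.cherry
    -- The auxiliary colours `a'` and `b'` allow the pair `q₂, o₁` to be recoloured with `b` by
    -- means of the cherry at `q₂`. The choice of `a'` avoids three colours and so needs `k ≥ 4`.
    obtain ⟨b', hb'⟩ := exists_colour_notMem (k := k) (s := {α₁ o₁, b})
      (lt_of_le_of_lt Finset.card_le_two (by omega))
    obtain ⟨a', ha'⟩ := exists_colour_notMem (k := k) (s := {α₁ o₁, b, b'})
      (lt_of_le_of_lt Finset.card_le_three (by omega))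
    simp only [Finset.mem_insert, Finset.mem_singleton, not_or] at hb' ha'
    obtain ⟨α₂, h2, r2, c1, c2, c3, c4, c5, c6⟩ :=
      h.exists_reach hdeg h1 e1 ha'.1 hb'.1 ha'.2.2
    have k2' : ¬ G.Adj q₂ o₁ := fun e => h.n₁₂ e.symm
    obtain ⟨α₃, h3, r3, -, d⟩ := exists_reach_prescribed hdeg h.rotate.cherry h2
      (c6.trans c5.symm) {q₁, q₂, o₁} (update (fun _ => b) q₁ a')
      (by
        have n := h.q₁₂.ne
        have n' := h.e₁.ne
        have n₁ := h.n₁₂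
        have irr : ∀ v, ¬ G.Adj v v := fun v => G.loopless.irrefl v
        have g1 : update (fun _ => b) q₁ a' q₁ = a' := by simp
        have g2 : update (fun _ => b) q₁ a' q₂ = b := by simp [n.symm]
        have g3 : update (fun _ => b) q₁ a' o₁ = b := by simp [n'.symm]
        intro p hp q hq hadj
        simp only [Finset.mem_insert, Finset.mem_singleton] at hp hq
        grind)
      (by simp [self_mem_comp, h.mem_q₁, h.mem_o₁])
      (by
        intro p _ _ _
        rw [c6]
        by_cases hp : p = q₁
        · subst hp; simpa using ha'.2.2
        · simpa [hp] using Ne.symm hb'.2)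
    simp only [Finset.mem_insert, Finset.mem_singleton, forall_eq_or_imp, forall_eq] at d
    have d2 : α₃ q₂ = b := by rw [d.2.1]; simp [h.q₁₂.ne.symm]
    have d3 : α₃ o₁ = b := by rw [d.2.2]; simp [h.e₁.ne.symm]
    obtain ⟨α₄, h4, r4, f1, f2, f3, f4, f5, f6⟩ :=
      h.exists_reach hdeg h3 (d3.trans d2.symm) (a := a) (b := c) (by rw [d3]; exact Ne.symm hb)
        (by rw [d3]; exact hc.2) (Ne.symm hc.1)
    exact ⟨α₄, h4, ((r1.trans r2).trans r3).trans r4, f1, f2, by rw [f3, d3], by rw [f4, d3],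
      f5, f6⟩
  obtain ⟨γ, g1, g2, g3, g4, g5, g6, g7, g8⟩ := key α hα hα'
  obtain ⟨δ, d1, d2, d3, d4, d5, d6, d7, d8⟩ := key β hβ hβ'
  refine g2.trans (Reach.trans ?_ d2.symm)
  refine reach_of_cover hG hdeg [(q₁, o₁, q₂), (q₂, o₂, q₃), (q₃, o₃, q₁)] (by simp)
    (by simp [h.cherry, h.rotate.cherry, h.rotate.rotate.cherry]) ?_
    g1 d1 (by simp [*]) (by simp [*])
  simp [h.mem_o₁, h.rotate.mem_o₁, h.rotate.rotate.mem_o₁, h.mem_q₁, h.rotate.mem_q₁,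
    h.rotate.rotate.mem_q₁]

end Brooks

/-! ### Regular graphs with a cherry contain one of the configurations. -/

section Clique

open scoped Classical
open Function Relation

variable {V : Type*} [Fintype V] {k : ℕ} {G : SimpleGraph V}

/-- `G` contains none of the configurations on which `reach_of_two_cherries`, `reach_of_claw` and
`reach_of_net` rely. -/
structure NoConfiguration (G : SimpleGraph V) : Prop where
  two : ∀ {x y z x' y' z'}, IsCherry G x y z → IsCherry G x' y' z' → y ∈ comp G x' y' z' →
    z ∈ comp G x' y' z' → y' ∈ comp G x y z → z' ∈ comp G x y z → False
  claw : ∀ {x y z q}, IsCherry G x y z → IsCherry G x y q → IsCherry G x z q → False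
  net : ∀ {q₁ q₂ q₃ o₁ o₂ o₃}, IsNet G q₁ q₂ q₃ o₁ o₂ o₃ → False

/-- A clique in which each vertex `q` has exactly one neighbour `o q` outside. -/
structure IsPendantClique (G : SimpleGraph V) (Q : Finset V) (o : V → V) : Prop where
  clique : ∀ s ∈ Q, ∀ t ∈ Q, s ≠ t → G.Adj s t
  adj : ∀ s ∈ Q, G.Adj s (o s)
  notMem : ∀ s ∈ Q, o s ∉ Q
  eq : ∀ s ∈ Q, ∀ t, t ∉ Q → G.Adj s t → t = o s

/-- The vertex `y` has `k - 2` neighbours in `Q`, hence exactly one more, `y'`. If `y' = w`, there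
is a claw at `w` with leaves `y`, `z` and a third neighbour of `w`. If not, the cherries at `z` with
leaves `x, w` and at `y` with leaves `t, y'` interlock. -/
theorem IsPendantClique.not_all_but_one {Q : Finset V} {o : V → V} (hQ : IsPendantClique G Q o)
    (hreg : ∀ v, (nbhd G v).card + 1 = k) (hcard : Q.card + 1 = k) (hk : 4 ≤ k)
    (hN : NoConfiguration G) {x z : V} (hx : x ∈ Q) (hz : z ∈ Q) (hxz : x ≠ z) (ho : o x ≠ o z)
    (hall : ∀ t ∈ Q, t ≠ z → o t = o x) : False := by
  set y := o x with hy
  set w := o z with hw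
  obtain ⟨t, ht, htn⟩ := Finset.exists_mem_notMem_of_card_lt_card (s := {x, z}) (t := Q)
    (lt_of_le_of_lt Finset.card_le_two (by omega))
  simp only [Finset.mem_insert, Finset.mem_singleton, not_or] at htn
  have hyQ : y ∉ Q := hQ.notMem x hx
  have hwQ : w ∉ Q := hQ.notMem z hz
  have ne : ∀ {a b : V}, a ∈ Q → b ∉ Q → a ≠ b := fun ha hb e => hb (e ▸ ha)
  have hty : G.Adj t y := hall t ht htn.2 ▸ hQ.adj t ht
  have hxy : G.Adj x y := hQ.adj x hx
  have hzw : G.Adj z w := hQ.adj z hz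
  have hzy : ¬ G.Adj z y := fun h => ho (hQ.eq z hz y hyQ h)
  have hNy : ∀ s ∈ Q, s ≠ z → ∀ u, u ∉ Q → G.Adj s u → u = y := fun s hs hsz u hu hsu =>
    (hQ.eq s hs u hu hsu).trans (hall s hs hsz)
  obtain ⟨y', hy', hy'n⟩ := Finset.exists_mem_notMem_of_card_lt_card (s := Q.erase z)
    (t := nbhd G y) (by rw [Finset.card_erase_of_mem hz]; have := hreg y; omega)
  rw [mem_nbhd] at hy'
  have hy'Q : y' ∉ Q := fun h => hy'n (Finset.mem_erase.2
    ⟨by rintro rfl; exact hzy hy'.symm, h⟩)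
  have hzx : G.Adj z x := hQ.clique z hz x hx hxz.symm
  have hzt : G.Adj z t := hQ.clique z hz t ht (Ne.symm htn.2)
  have hzy' : z ≠ y' := ne hz hy'Q
  by_cases hyw : y' = w
  · subst hyw
    have hwy : G.Adj w y := hy'.symm
    obtain ⟨q, hq, hqn⟩ := Finset.exists_mem_notMem_of_card_lt_card (s := {y, z})
      (t := nbhd G w) (lt_of_le_of_lt Finset.card_le_two (by have := hreg w; omega))
    rw [mem_nbhd] at hq
    simp only [Finset.mem_insert, Finset.mem_singleton, not_or] at hqn
    have hqQ : q ∉ Q := fun h => ho (hNy q h hqn.2 w hwQ hq.symm).symm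
    refine hN.claw (x := w) (y := y) (z := z) (q := q)
      ⟨hwy, hzw.symm, (ne hz hyQ).symm, fun h => hzy h.symm⟩
      ⟨hwy, hq, Ne.symm hqn.1, fun h => ?_⟩
      ⟨hzw.symm, hq, Ne.symm hqn.2, fun h => hq.ne (hQ.eq z hz q hqQ h).symm⟩
    -- Adjacency of `y` and `q` would give `y` too many neighbours: `k - 2` in `Q`, and also `w` and
    -- `q`.
    have hsub : insert w (insert q (Q.erase z)) ⊆ nbhd G y := by
      intro s hs
      simp only [Finset.mem_insert, Finset.mem_erase] at hs
      rw [mem_nbhd]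
      rcases hs with rfl | rfl | ⟨hsz, hs⟩
      · exact hwy.symm
      · exact h
      · have := hall s hs hsz
        exact (this ▸ hQ.adj s hs).symm
    have h1 := Finset.card_le_card hsub
    rw [Finset.card_insert_of_notMem (by simp [hq.ne, hwQ]),
      Finset.card_insert_of_notMem (by simp [hqQ]), Finset.card_erase_of_mem hz] at h1
    have := hreg y
    omega
  · have c1 : IsCherry G z x w := ⟨hzx, hzw, ne hx hwQ, fun h => ho (hNy x hx hxz w hwQ h).symm⟩
    have c2 : IsCherry G y t y' := ⟨hty.symm, hy', ne ht hy'Q, fun h =>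
      hy'.ne (hNy t ht htn.2 y' hy'Q h).symm⟩
    have m1 : x ∈ comp G y t y' :=
      comp_adj (self_mem_comp G _ _ _) hxy.symm (Ne.symm htn.1) (ne hx hy'Q)
    have m2 : t ∈ comp G z x w := comp_adj (self_mem_comp G _ _ _) hzt htn.1 (ne ht hwQ)
    refine hN.two c1 c2 m1 ?_ m2 ?_
    · exact comp_adj (comp_adj m1 hzx.symm (Ne.symm htn.2) hzy') hzw (ne ht hwQ).symm
        (Ne.symm hyw)
    · exact comp_adj (comp_adj m2 hty (ne hx hyQ).symm ho) hy' (ne hx hy'Q).symm hyw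

/-- Three values of `o` give a net. Two values, each taken at least twice, give the interlocking
cherries at `x` and `z`. A value taken only once is excluded by `not_all_but_one`. -/
theorem IsPendantClique.const {Q : Finset V} {o : V → V} (hQ : IsPendantClique G Q o)
    (hreg : ∀ v, (nbhd G v).card + 1 = k) (hcard : Q.card + 1 = k) (hk : 4 ≤ k)
    (hN : NoConfiguration G) {x z : V} (hx : x ∈ Q) (hz : z ∈ Q) : o x = o z := by
  by_contra ho
  have hxz : x ≠ z := by rintro rfl; exact ho rfl
  have ne : ∀ {a b : V}, a ∈ Q → b ∉ Q → a ≠ b := fun ha hb e => hb (e ▸ ha)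
  have nadj : ∀ s ∈ Q, ∀ t ∈ Q, o s ≠ o t → ¬ G.Adj (o s) t := fun s hs t ht h hadj =>
    h (hQ.eq t ht (o s) (hQ.notMem s hs) hadj.symm)
  by_cases h1 : ∃ t ∈ Q, o t ≠ o x ∧ o t ≠ o z
  · obtain ⟨t, ht, htx, htz⟩ := h1
    have htx' : t ≠ x := by rintro rfl; exact htx rfl
    have htz' : t ≠ z := by rintro rfl; exact htz rfl
    exact hN.net (q₁ := x) (q₂ := z) (q₃ := t) (o₁ := o x) (o₂ := o z) (o₃ := o t)
      ⟨hQ.clique x hx z hz hxz, hQ.clique z hz t ht (Ne.symm htz'), hQ.clique t ht x hx htx',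
        hQ.adj x hx, hQ.adj z hz, hQ.adj t ht, nadj x hx z hz ho, nadj x hx t ht (Ne.symm htx),
        nadj z hz x hx (Ne.symm ho), nadj z hz t ht (Ne.symm htz), nadj t ht x hx htx,
        nadj t ht z hz htz, ho, Ne.symm htz, htx⟩
  push Not at h1
  by_cases h2 : ∃ t ∈ Q, t ≠ x ∧ o t = o x
  · by_cases h3 : ∃ t ∈ Q, t ≠ z ∧ o t = o z
    · obtain ⟨t, ht, htx, hto⟩ := h2
      obtain ⟨s, hs, hsz, hso⟩ := h3
      have htz : t ≠ z := by rintro rfl; exact ho hto.symm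
      have hsx : s ≠ x := by rintro rfl; exact ho hso
      have hty : G.Adj t (o x) := hto ▸ hQ.adj t ht
      have hsw : G.Adj s (o z) := hso ▸ hQ.adj s hs
      refine hN.two (x := x) (y := o x) (z := z) (x' := z) (y' := o z) (z' := x)
        ⟨hQ.adj x hx, hQ.clique x hx z hz hxz, (ne hz (hQ.notMem x hx)).symm, nadj x hx z hz ho⟩
        ⟨hQ.adj z hz, hQ.clique z hz x hx hxz.symm, (ne hx (hQ.notMem z hz)).symm,
          nadj z hz x hx (Ne.symm ho)⟩ ?_ (self_mem_comp G _ _ _) ?_ (self_mem_comp G _ _ _)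
      · exact comp_adj (comp_adj (self_mem_comp G _ _ _) (hQ.clique z hz t ht htz.symm)
          (ne ht (hQ.notMem z hz)) htx) hty ho (ne hx (hQ.notMem x hx)).symm
      · exact comp_adj (comp_adj (self_mem_comp G _ _ _) (hQ.clique x hx s hs hsx.symm)
          (ne hs (hQ.notMem x hx)) hsz) hsw (Ne.symm ho) (ne hz (hQ.notMem z hz)).symm
    · push Not at h3
      refine hQ.not_all_but_one hreg hcard hk hN hx hz hxz ho fun t ht htz => ?_
      by_contra h
      exact h3 t ht htz (h1 t ht h)
  · push Not at h2
    refine hQ.not_all_but_one hreg hcard hk hN hz hx hxz.symm (Ne.symm ho) fun t ht htx => ?_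
    exact h1 t ht (h2 t ht htx)

/-- The nonadjacent pairs of neighbours of `x` form a star with centre `y`. -/
theorem NoConfiguration.exists_star (hN : NoConfiguration G) {x y₀ z₀ : V}
    (hc : IsCherry G x y₀ z₀) :
    ∃ y z, IsCherry G x y z ∧ ∀ s t, G.Adj x s → G.Adj x t → s ≠ y → t ≠ y → s ≠ t → G.Adj s t := by
  -- Nonadjacent pairs of neighbours of `x` pairwise meet, by `two`, and no three of them form a
  -- triangle, by `claw`. Such a family of pairs is a star.
  have disj : ∀ {y z s t}, IsCherry G x y z → IsCherry G x s t → s ≠ y → s ≠ z → t ≠ y → t ≠ z →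
      False := fun h h' h1 h2 h3 h4 =>
    hN.two h h' (comp_adj (self_mem_comp G _ _ _) h.left h1.symm h3.symm)
      (comp_adj (self_mem_comp G _ _ _) h.right h2.symm h4.symm)
      (comp_adj (self_mem_comp G _ _ _) h'.left h1 h2)
      (comp_adj (self_mem_comp G _ _ _) h'.right h3 h4)
  obtain ⟨y, z, hyz, hz⟩ : ∃ y z, IsCherry G x y z ∧
      ∀ s, G.Adj x s → s ≠ y → s ≠ z → G.Adj z s := by
    by_cases h : ∃ p, G.Adj x p ∧ p ≠ y₀ ∧ p ≠ z₀ ∧ ¬ G.Adj z₀ p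
    · obtain ⟨p, hxp, hpy, hpz, hzp⟩ := h
      refine ⟨z₀, y₀, hc.symm, fun s hs hsz hsy => ?_⟩
      by_contra hys
      by_cases hsp : s = p
      · subst hsp
        exact hN.claw hc ⟨hc.left, hxp, hpy.symm, hys⟩ ⟨hc.right, hxp, hpz.symm, hzp⟩
      · exact disj (y := z₀) (z := p) (s := y₀) (t := s) ⟨hc.right, hxp, hpz.symm, hzp⟩
          ⟨hc.left, hs, hsy.symm, hys⟩ hc.ne hpy.symm hsz hsp
    · push Not at h
      exact ⟨y₀, z₀, hc, h⟩
  refine ⟨y, z, hyz, fun s t hs ht hsy hty hst => ?_⟩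
  by_cases hsz : s = z
  · subst hsz
    exact hz t ht hty hst.symm
  by_cases htz : t = z
  · subst htz
    exact (hz s hs hsy hst).symm
  by_contra hn
  exact disj hyz ⟨hs, ht, hst, hn⟩ hsy hsz hty htz

/-- Removing the centre `y` of the star from the closed neighbourhood of `x` leaves a clique of `k -
1` vertices, each with exactly one neighbour outside. By `const` this neighbour is always `y`, so
`z` is adjacent to `y`, against the choice of the cherry. -/
theorem not_noConfiguration (hreg : ∀ v, (nbhd G v).card + 1 = k) (hk : 4 ≤ k) {x y₀ z₀ : V}
    (hc : IsCherry G x y₀ z₀) : ¬ NoConfiguration G := by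
  intro hN
  obtain ⟨y, z, hyz, hcl⟩ := hN.exists_star hc
  set Q : Finset V := insert x ((nbhd G x).erase y) with hQdef
  have hyN : y ∈ nbhd G x := by simpa using hyz.left
  have hcard : Q.card + 1 = k := by
    rw [hQdef, Finset.card_insert_of_notMem (by simp), Finset.card_erase_of_mem hyN]
    have := Finset.card_pos.2 ⟨y, hyN⟩
    have := hreg x
    omega
  have hclique : ∀ s ∈ Q, ∀ t ∈ Q, s ≠ t → G.Adj s t := by
    intro s hs t ht hst
    simp only [Q, Finset.mem_insert, Finset.mem_erase, mem_nbhd] at hs ht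
    rcases hs with rfl | ⟨hsy, hs⟩ <;> rcases ht with rfl | ⟨hty, ht⟩
    · exact absurd rfl hst
    · exact ht
    · exact hs.symm
    · exact hcl s t hs ht hsy hty hst
  have hout : ∀ s : V, ∃ o, s ∈ Q → G.Adj s o ∧ o ∉ Q ∧ ∀ t, t ∉ Q → G.Adj s t → t = o := by
    intro s
    by_cases hs : s ∈ Q
    · have hsub : Q.erase s ⊆ nbhd G s := by
        intro t ht
        rw [Finset.mem_erase] at ht
        simpa using hclique s hs t ht.2 ht.1.symm
      have h1 : (nbhd G s \ Q.erase s).card = 1 := by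
        rw [Finset.card_sdiff_of_subset hsub, Finset.card_erase_of_mem hs]
        have := hreg s
        omega
      obtain ⟨o, ho⟩ := Finset.card_eq_one.1 h1
      have key : ∀ t, (G.Adj s t ∧ t ∉ Q) ↔ t = o := by
        intro t
        rw [← Finset.mem_singleton, ← ho, Finset.mem_sdiff, mem_nbhd, Finset.mem_erase]
        constructor
        · exact fun h => ⟨h.1, fun h' => h.2 h'.2⟩
        · exact fun h => ⟨h.1, fun h' => h.2 ⟨h.1.ne', h'⟩⟩
      exact ⟨o, fun _ => ⟨((key o).2 rfl).1, ((key o).2 rfl).2, fun t h h' => (key t).1 ⟨h', h⟩⟩⟩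
    · exact ⟨s, fun h => absurd h hs⟩
  choose o ho using hout
  have hPC : IsPendantClique G Q o :=
    ⟨hclique, fun s hs => (ho s hs).1, fun s hs => (ho s hs).2.1, fun s hs => (ho s hs).2.2⟩
  have hx : x ∈ Q := by simp [Q]
  have hz : z ∈ Q := by simp [Q, hyz.right, hyz.ne.symm]
  have hy : y ∉ Q := by simp [Q, hyz.left.ne.symm]
  have e1 : y = o x := hPC.eq x hx y hy hyz.left
  have e2 := hPC.const hreg hcard hk hN hx hz
  have := hPC.adj z hz
  rw [← e2, ← e1] at this
  exact hyz.nadj this.symm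

/-- In a connected graph of maximum degree at most `k - 1`, where `k ≥ 4`, any two `k`-colourings
with free vertices are connected by recolourings of single vertices. -/
theorem reach_of_free (hG : G.Preconnected) (hk : 4 ≤ k) (hdeg : ∀ v, (nbhd G v).card + 1 ≤ k)
    {α β : V → Fin k} (hα : Proper G α) (hβ : Proper G β) (hα' : ∃ v, Free G α v)
    (hβ' : ∃ v, Free G β v) : Reach G α β := by
  by_cases hreg : ∀ v, (nbhd G v).card + 1 = k
  · by_contra hR
    obtain ⟨x, hx⟩ := hα'
    obtain ⟨p, q, hpq, -⟩ := hx.exists_cherry hreg hα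
    exact not_noConfiguration hreg hk hpq
      ⟨fun c c' h1 h2 h3 h4 => hR (reach_of_two_cherries hG hk hreg c c' h1 h2 h3 h4 hα hβ
        ⟨x, hx⟩ hβ'), fun c₁ c₂ c₃ => hR (reach_of_claw hG hk hreg c₁ c₂ c₃ hα hβ ⟨x, hx⟩ hβ'),
      fun h => hR (reach_of_net h hG hk hreg hα hβ ⟨x, hx⟩ hβ')⟩
  · push Not at hreg
    obtain ⟨v, hv⟩ := hreg
    exact reach_of_not_regular hG hdeg (lt_of_le_of_ne (hdeg v) hv) hα hβ

end Clique

/-! ### Total variation distance. -/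

section TotalVariation

variable {Ω : Type*} [Fintype Ω]

theorem bddAbove_tvDist (μ ν : Ω → ℝ) :
    BddAbove (Set.range fun A : Finset Ω => |∑ x ∈ A, μ x - ∑ x ∈ A, ν x|) :=
  Set.Finite.bddAbove (Set.finite_range _)

theorem tvDist_nonneg (μ ν : Ω → ℝ) : 0 ≤ tvDist μ ν := Real.iSup_nonneg fun _ => abs_nonneg _

theorem tvDist_self (μ : Ω → ℝ) : tvDist μ μ = 0 := by simp [tvDist]

theorem tvDist_triangle (μ ν ρ : Ω → ℝ) : tvDist μ ρ ≤ tvDist μ ν + tvDist ν ρ :=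
  ciSup_le fun A => (abs_sub_le _ (∑ x ∈ A, ν x) _).trans
    (add_le_add (le_ciSup (bddAbove_tvDist μ ν) A) (le_ciSup (bddAbove_tvDist ν ρ) A))

theorem tvDist_le_sum (μ ν : Ω → ℝ) : tvDist μ ν ≤ ∑ x, |μ x - ν x| := by
  refine ciSup_le fun A => ?_
  rw [← Finset.sum_sub_distrib]
  exact (Finset.abs_sum_le_sum_abs _ _).trans
    (Finset.sum_le_sum_of_subset_of_nonneg (Finset.subset_univ A) fun _ _ _ => abs_nonneg _)

end TotalVariation

/-! ### Convergence of finite symmetric chains. -/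

section Doeblin

open Matrix

variable {Ω : Type*} [Fintype Ω] {P Q : Matrix Ω Ω ℝ} {S : Finset Ω}

/-- A stochastic matrix for which no transition leaves `S`. -/
structure IsStochasticOn (P : Matrix Ω Ω ℝ) (S : Finset Ω) : Prop where
  nonneg : ∀ a b, 0 ≤ P a b
  sum_eq : ∀ a, ∑ b, P a b = 1
  closed : ∀ a ∈ S, ∀ b, b ∉ S → P a b = 0

theorem IsStochasticOn.mul (hP : IsStochasticOn P S) (hQ : IsStochasticOn Q S) :
    IsStochasticOn (P * Q) S where
  nonneg a b := Finset.sum_nonneg fun c _ => mul_nonneg (hP.nonneg a c) (hQ.nonneg c b)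
  sum_eq a := by
    simp only [Matrix.mul_apply]
    rw [Finset.sum_comm]
    simp only [← Finset.mul_sum, hQ.sum_eq, mul_one, hP.sum_eq]
  closed a ha b hb := by
    rw [Matrix.mul_apply]
    refine Finset.sum_eq_zero fun c _ => ?_
    by_cases hc : c ∈ S
    · rw [hQ.closed c hc b hb, mul_zero]
    · rw [hP.closed a ha c hc, zero_mul]

theorem IsStochasticOn.pow [DecidableEq Ω] (hP : IsStochasticOn P S) (t : ℕ) :
    IsStochasticOn (P ^ t) S := by
  induction t with
  | zero =>
    rw [pow_zero]
    refine ⟨fun a b => ?_, fun a => by simp [Matrix.one_apply], fun a ha b hb => ?_⟩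
    · rw [Matrix.one_apply]; split_ifs <;> norm_num
    · exact Matrix.one_apply_ne (by rintro rfl; exact hb ha)
  | succ t ih => rw [pow_succ]; exact ih.mul hP

theorem IsStochasticOn.sum_vecMul (hP : IsStochasticOn P S) (ν : Ω → ℝ) :
    ∑ b, (ν ᵥ* P) b = ∑ a, ν a := by
  simp only [vecMul, dotProduct]
  rw [Finset.sum_comm]
  simp only [← Finset.mul_sum, hP.sum_eq, mul_one]

theorem IsStochasticOn.vecMul_eq_zero (hP : IsStochasticOn P S) {ν : Ω → ℝ}
    (hν : ∀ a, a ∉ S → ν a = 0) {b : Ω} (hb : b ∉ S) : (ν ᵥ* P) b = 0 := by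
  simp only [vecMul, dotProduct]
  refine Finset.sum_eq_zero fun a _ => ?_
  by_cases ha : a ∈ S
  · rw [hP.closed a ha b hb, mul_zero]
  · rw [hν a ha, zero_mul]

theorem IsStochasticOn.sum_abs_vecMul_le (hP : IsStochasticOn P S) (ν : Ω → ℝ) :
    ∑ b, |(ν ᵥ* P) b| ≤ ∑ a, |ν a| := by
  calc ∑ b, |(ν ᵥ* P) b| ≤ ∑ b, ∑ a, |ν a| * P a b := by
        refine Finset.sum_le_sum fun b _ => (Finset.abs_sum_le_sum_abs _ _).trans ?_
        exact Finset.sum_le_sum fun a _ => by rw [abs_mul, abs_of_nonneg (hP.nonneg a b)]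
    _ = ∑ a, |ν a| := by
        rw [Finset.sum_comm]
        simp only [← Finset.mul_sum, hP.sum_eq, mul_one]

/-- Entries bounded below by `δ` on `S` contract the difference of two laws on `S`. -/
theorem IsStochasticOn.sum_abs_vecMul_le_mul (hP : IsStochasticOn P S) {δ : ℝ}
    (hδ : ∀ a ∈ S, ∀ b ∈ S, δ ≤ P a b) {ν : Ω → ℝ} (hν : ∀ a, a ∉ S → ν a = 0)
    (h0 : ∑ a, ν a = 0) : ∑ b, |(ν ᵥ* P) b| ≤ (1 - δ * S.card) * ∑ a, |ν a| := by
  have hsum : ∀ f : Ω → ℝ, (∀ a, a ∉ S → f a = 0) → ∑ a, f a = ∑ a ∈ S, f a := fun f hf =>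
    (Finset.sum_subset (Finset.subset_univ S) fun a _ ha => hf a ha).symm
  have hrow : ∀ a ∈ S, ∑ b ∈ S, (P a b - δ) = 1 - δ * S.card := by
    intro a ha
    rw [Finset.sum_sub_distrib, ← hsum _ (hP.closed a ha), hP.sum_eq, Finset.sum_const,
      nsmul_eq_mul, mul_comm]
  rw [hsum _ fun b hb => by rw [hP.vecMul_eq_zero hν hb, abs_zero],
    hsum _ fun a ha => by rw [hν a ha, abs_zero]]
  calc ∑ b ∈ S, |(ν ᵥ* P) b| ≤ ∑ b ∈ S, ∑ a ∈ S, |ν a| * (P a b - δ) := by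
        refine Finset.sum_le_sum fun b hb => ?_
        -- As `ν` has total mass zero, subtracting the constant `δ` from the entries changes
        -- nothing.
        have : (ν ᵥ* P) b = ∑ a ∈ S, ν a * (P a b - δ) := by
          simp only [mul_sub, Finset.sum_sub_distrib, ← Finset.sum_mul]
          rw [← hsum ν hν, h0, zero_mul, sub_zero]
          exact hsum _ fun a ha => by rw [hν a ha, zero_mul]
        rw [this]
        refine (Finset.abs_sum_le_sum_abs _ _).trans (Finset.sum_le_sum fun a ha => ?_)
        rw [abs_mul, abs_of_nonneg (sub_nonneg.2 (hδ a ha b hb))]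
    _ = ∑ a ∈ S, |ν a| * (1 - δ * S.card) := by
        rw [Finset.sum_comm]
        exact Finset.sum_congr rfl fun a ha => by rw [← Finset.mul_sum, hrow a ha]
    _ = (1 - δ * S.card) * ∑ a ∈ S, |ν a| := by rw [← Finset.sum_mul, mul_comm]

/-- The `ℓ¹` norm never increases, and every `N` steps it shrinks by the factor `1 - δ|S|`, where
`δ` is the least entry of `P ^ N` on `S`. -/
theorem IsStochasticOn.tendsto_sum_abs [DecidableEq Ω] (hP : IsStochasticOn P S) {N : ℕ}
    (hN : ∀ a ∈ S, ∀ b ∈ S, 0 < (P ^ N) a b) {ν : Ω → ℝ} (hν : ∀ a, a ∉ S → ν a = 0)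
    (h0 : ∑ a, ν a = 0) : Tendsto (fun t => ∑ b, |(ν ᵥ* P ^ t) b|) atTop (𝓝 0) := by
  rcases S.eq_empty_or_nonempty with rfl | hS
  · have : ν = 0 := funext fun a => hν a (by simp)
    simp [this]
  obtain ⟨δ, hδ0, hδ⟩ : ∃ δ : ℝ, 0 < δ ∧ ∀ a ∈ S, ∀ b ∈ S, δ ≤ (P ^ N) a b := by
    obtain ⟨p, hp, hmin⟩ := Finset.exists_min_image (S ×ˢ S) (fun p => (P ^ N) p.1 p.2)
      (hS.product hS)
    rw [Finset.mem_product] at hp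
    exact ⟨_, hN p.1 hp.1 p.2 hp.2, fun a ha b hb => hmin (a, b) (Finset.mem_product.2 ⟨ha, hb⟩)⟩
  have hS' : (0 : ℝ) < S.card := by exact_mod_cast hS.card_pos
  set ρ : ℝ := 1 - δ * S.card with hρ
  have hρ1 : ρ < 1 := by have := mul_pos hδ0 hS'; linarith
  have hρ0 : 0 ≤ ρ := by
    obtain ⟨a, ha⟩ := hS
    have h1 : ∑ b ∈ S, δ ≤ ∑ b ∈ S, (P ^ N) a b := Finset.sum_le_sum fun b hb => hδ a ha b hb
    have h2 : ∑ b ∈ S, (P ^ N) a b ≤ 1 := by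
      rw [← (hP.pow N).sum_eq a]
      exact Finset.sum_le_sum_of_subset_of_nonneg (Finset.subset_univ S)
        fun b _ _ => (hP.pow N).nonneg a b
    rw [Finset.sum_const, nsmul_eq_mul, mul_comm] at h1
    linarith
  have hgeom : ∀ j, ∑ b, |(ν ᵥ* P ^ (N * j)) b| ≤ ρ ^ j * ∑ a, |ν a| := by
    intro j
    induction j with
    | zero => simp
    | succ j ih =>
      rw [Nat.mul_succ, pow_add, ← Matrix.vecMul_vecMul]
      refine ((hP.pow N).sum_abs_vecMul_le_mul hδ
        (fun a ha => (hP.pow _).vecMul_eq_zero hν ha)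
        (((hP.pow _).sum_vecMul ν).trans h0)).trans ?_
      rw [pow_succ', mul_assoc]
      exact mul_le_mul_of_nonneg_left ih hρ0
  have hanti : Antitone fun t => ∑ b, |(ν ᵥ* P ^ t) b| := by
    refine antitone_nat_of_succ_le fun t => ?_
    rw [pow_succ, ← Matrix.vecMul_vecMul]
    exact hP.sum_abs_vecMul_le _
  have hlim : Tendsto (fun j : ℕ => ρ ^ j * ∑ a, |ν a|) atTop (𝓝 0) := by
    simpa using (tendsto_pow_atTop_nhds_zero_of_lt_one hρ0 hρ1).mul_const (∑ a, |ν a|)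
  rw [Metric.tendsto_atTop]
  intro ε hε
  obtain ⟨j, hj⟩ := (hlim.eventually_lt_const hε).exists
  refine ⟨N * j, fun t ht => ?_⟩
  rw [Real.dist_0_eq_abs, abs_of_nonneg (Finset.sum_nonneg fun _ _ => abs_nonneg _)]
  exact ((hanti ht).trans (hgeom j)).trans_lt hj

theorem sum_uniformOn (hS : S.Nonempty) : ∑ x, uniformOn S x = 1 := by
  have : (S.card : ℝ) ≠ 0 := by exact_mod_cast hS.card_pos.ne'
  simp [uniformOn, Finset.sum_ite_mem, this]

/-- The uniform distribution on `S` is stationary for a symmetric matrix. -/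
theorem IsStochasticOn.uniformOn_vecMul (hP : IsStochasticOn P S) (hsymm : ∀ a b, P a b = P b a) :
    uniformOn S ᵥ* P = uniformOn S := by
  funext b
  by_cases hb : b ∈ S
  · have : ∀ a, uniformOn S a * P a b = 1 / (S.card : ℝ) * P b a := by
      intro a
      by_cases ha : a ∈ S
      · simp [uniformOn, ha, hsymm a b]
      · simp [uniformOn, ha, hP.closed b hb a ha]
    simp only [vecMul, dotProduct, this, ← Finset.mul_sum, hP.sum_eq, mul_one]
    simp [uniformOn, hb]
  · rw [hP.vecMul_eq_zero (fun a ha => by simp [uniformOn, ha]) hb]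
    simp [uniformOn, hb]

theorem IsStochasticOn.uniformOn_vecMul_pow [DecidableEq Ω] (hP : IsStochasticOn P S)
    (hsymm : ∀ a b, P a b = P b a) (t : ℕ) : uniformOn S ᵥ* P ^ t = uniformOn S := by
  induction t with
  | zero => simp
  | succ t ih => rw [pow_succ, ← Matrix.vecMul_vecMul, ih, hP.uniformOn_vecMul hsymm]

/-- A symmetric stochastic matrix with positive diagonal, irreducible on `S`, converges to the
uniform distribution on `S`. -/
theorem IsStochasticOn.tendsto_tvDist [DecidableEq Ω] (hP : IsStochasticOn P S)
    (hsymm : ∀ a b, P a b = P b a) (hdiag : ∀ a, 0 < P a a)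
    (hirr : ∀ a ∈ S, ∀ b ∈ S, ∃ t, 0 < (P ^ t) a b) {α : Ω} (hα : α ∈ S) :
    Tendsto (fun t => tvDist (pointMass α ᵥ* P ^ t) (uniformOn S)) atTop (𝓝 0) := by
  -- The positive diagonal keeps positive entries positive, so one exponent, the sum of the
  -- individual ones, serves all pairs.
  have hmono : ∀ a b t s, t ≤ s → 0 < (P ^ t) a b → 0 < (P ^ s) a b := by
    intro a b t s hts ht
    induction s, hts using Nat.le_induction with
    | base => exact ht
    | succ s _ ih =>
      rw [pow_succ, Matrix.mul_apply]
      exact Finset.sum_pos' (fun c _ => mul_nonneg ((hP.pow s).nonneg a c) (hP.nonneg c b))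
        ⟨b, Finset.mem_univ b, mul_pos ih (hdiag b)⟩
  have hT : ∀ p : Ω × Ω, ∃ t, p.1 ∈ S → p.2 ∈ S → 0 < (P ^ t) p.1 p.2 := by
    intro p
    by_cases h : p.1 ∈ S ∧ p.2 ∈ S
    · obtain ⟨t, ht⟩ := hirr p.1 h.1 p.2 h.2
      exact ⟨t, fun _ _ => ht⟩
    · exact ⟨0, fun h1 h2 => absurd ⟨h1, h2⟩ h⟩
  choose T hT using hT
  have hN : ∀ a ∈ S, ∀ b ∈ S, 0 < (P ^ ∑ p, T p) a b := fun a ha b hb =>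
    hmono a b _ _ (Finset.single_le_sum (fun p _ => Nat.zero_le (T p)) (Finset.mem_univ (a, b)))
      (hT (a, b) ha hb)
  have hsum : ∑ x, (pointMass α - uniformOn S) x = 0 := by
    simp only [Pi.sub_apply, Finset.sum_sub_distrib, sum_uniformOn ⟨α, hα⟩]
    rw [Finset.sum_eq_single α (fun b _ hb => by simp [pointMass, hb]) (by simp)]
    simp [pointMass]
  have hlim := hP.tendsto_sum_abs hN (ν := pointMass α - uniformOn S) (fun a ha => by
    have : a ≠ α := by rintro rfl; exact ha hα
    simp [pointMass, uniformOn, this, ha]) hsum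
  refine squeeze_zero (fun _ => tvDist_nonneg _ _) (fun t => ?_) hlim
  refine (tvDist_le_sum _ _).trans_eq ?_
  rw [Matrix.sub_vecMul, hP.uniformOn_vecMul_pow hsymm]
  rfl

/-- The distance of the uniform distribution on a subset to that on everything. -/
theorem tvDist_uniformOn_univ_le [DecidableEq Ω] (hS : S.Nonempty) :
    tvDist (uniformOn S) (uniformOn Finset.univ) ≤ 2 * ((Sᶜ.card : ℝ) / Fintype.card Ω) := by
  refine (tvDist_le_sum _ _).trans_eq ?_
  have hs : (0 : ℝ) < S.card := by exact_mod_cast hS.card_pos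
  have hle : (S.card : ℝ) ≤ Fintype.card Ω := by exact_mod_cast Finset.card_le_univ S
  have hc : (Sᶜ.card : ℝ) = Fintype.card Ω - S.card := by
    rw [Finset.card_compl, Nat.cast_sub (Finset.card_le_univ S)]
  have hΩ : (0 : ℝ) < Fintype.card Ω := hs.trans_le hle
  rw [← Finset.sum_add_sum_compl S]
  have h1 : ∀ x ∈ S, |uniformOn S x - uniformOn Finset.univ x| =
      1 / (S.card : ℝ) - 1 / Fintype.card Ω := by
    intro x hx
    simp only [uniformOn, hx, if_true, Finset.mem_univ, Finset.card_univ]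
    exact abs_of_nonneg (sub_nonneg.2 (one_div_le_one_div_of_le hs hle))
  have h2 : ∀ x ∈ Sᶜ, |uniformOn S x - uniformOn Finset.univ x| = 1 / (Fintype.card Ω : ℝ) := by
    intro x hx
    rw [Finset.mem_compl] at hx
    simp only [uniformOn, hx, if_false, if_true, Finset.mem_univ, Finset.card_univ, zero_sub,
      abs_neg]
    exact abs_of_pos (one_div_pos.2 hΩ)
  rw [Finset.sum_congr rfl h1, Finset.sum_congr rfl h2, Finset.sum_const, Finset.sum_const,
    nsmul_eq_mul, nsmul_eq_mul, hc]
  field_simp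
  ring

end Doeblin

/-! ### Glauber dynamics as a symmetric chain on the non-frozen colourings. -/

section Chain

open scoped Classical
open Function Relation

variable {V : Type*} {k : ℕ} {G : SimpleGraph V}

theorem proper_coe (α : G.Coloring (Fin k)) : Proper G α := fun _ _ h => α.valid h

theorem not_isFrozen_iff (α : G.Coloring (Fin k)) : ¬ IsFrozen G α ↔ ∃ v, Free G α v := by
  simp [IsFrozen, Free]

variable [Fintype V]

theorem coe_recolour {α : G.Coloring (Fin k)} {v : V} {c : Fin k}
    (h : ∀ u, G.Adj v u → α u ≠ c) : (recolour G α v c : V → Fin k) = update α v c := by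
  rw [recolour, dif_pos h]
  rfl

theorem recolour_self (α : G.Coloring (Fin k)) (v : V) : recolour G α v (α v) = α := by
  apply DFunLike.coe_injective
  rw [coe_recolour fun u h => (α.valid h).symm, update_eq_self]

theorem recolour_eq_or (α : G.Coloring (Fin k)) (v : V) (c : Fin k) :
    recolour G α v c = α ∨ (recolour G α v c : V → Fin k) = update α v c := by
  by_cases h : ∀ u, G.Adj v u → α u ≠ c
  · exact .inr (coe_recolour h)
  · exact .inl (dif_neg h)

/-- Proper moves are reversible; this underlies both the symmetry of the chain and the closedness of
the non-frozen colourings. -/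
theorem recolour_recolour {α β : G.Coloring (Fin k)} {v : V} {c : Fin k} (hne : α ≠ β)
    (h : recolour G α v c = β) : c = β v ∧ recolour G β v (α v) = α := by
  rcases recolour_eq_or α v c with e | e
  · exact absurd (e.symm.trans h) hne
  rw [h] at e
  have hu : ∀ u, u ≠ v → β u = α u := fun u hu => by rw [e, update_of_ne hu]
  refine ⟨by rw [e, update_self], DFunLike.coe_injective ?_⟩
  rw [coe_recolour fun u hvu => by rw [hu u hvu.ne']; exact (α.valid hvu).symm, e]
  simp

theorem not_isFrozen_recolour {α β : G.Coloring (Fin k)} {v : V} {c : Fin k}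
    (hα : ¬ IsFrozen G α) (h : recolour G α v c = β) : ¬ IsFrozen G β := by
  by_cases hne : α = β
  · exact hne ▸ hα
  obtain ⟨rfl, h'⟩ := recolour_recolour hne h
  rcases recolour_eq_or β v (α v) with e | e
  · exact absurd (h'.symm.trans e) hne
  rw [h'] at e
  rw [not_isFrozen_iff]
  -- After an actual move, the former colour of `v` is missing from its closed neighbourhood.
  refine ⟨v, α v, fun u hu => ?_⟩
  rcases hu with rfl | hu
  · intro hc
    rw [← hc, update_eq_self] at e
    exact hne (DFunLike.coe_injective e)
  · have : α u = β u := by rw [e, update_of_ne hu.ne']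
    rw [← this]
    exact (α.valid hu).symm

/-- For distinct `α` and `β`, reversal `(v, c) ↦ (v, α v)` injects the updates from `α` to `β` into
those from `β` to `α`. -/
theorem transition_symm (α β : G.Coloring (Fin k)) : transition G k α β = transition G k β α := by
  have key : ∀ α β : G.Coloring (Fin k), α ≠ β →
      (Finset.univ.filter fun p : V × Fin k => recolour G α p.1 p.2 = β).card ≤
        (Finset.univ.filter fun p : V × Fin k => recolour G β p.1 p.2 = α).card := by
    intro α β hne
    refine Finset.card_le_card_of_injOn (fun p => (p.1, α p.1)) (fun p hp => ?_)
      (fun p hp q hq hpq => ?_)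
    · simp only [Finset.mem_coe, Finset.mem_filter, Finset.mem_univ, true_and] at hp ⊢
      exact (recolour_recolour hne hp).2
    · simp only [Finset.mem_coe, Finset.mem_filter, Finset.mem_univ, true_and] at hp hq
      have h1 : p.1 = q.1 := (Prod.ext_iff.1 hpq).1
      exact Prod.ext h1 (by
        rw [(recolour_recolour hne hp).1, (recolour_recolour hne hq).1, h1])
  by_cases hne : α = β
  · rw [hne]
  · simp only [transition, Matrix.of_apply]
    rw [le_antisymm (key α β hne) (key β α (Ne.symm hne))]

theorem transition_pos [Nonempty V] {α β : G.Coloring (Fin k)} {v : V} {c : Fin k}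
    (h : recolour G α v c = β) : 0 < transition G k α β := by
  have hk : 0 < k := Fin.pos c
  have hcard : 0 < (Finset.univ.filter fun p : V × Fin k => recolour G α p.1 p.2 = β).card :=
    Finset.card_pos.2 ⟨(v, c), by simpa using h⟩
  simp only [transition, Matrix.of_apply]
  have := Fintype.card_pos (α := V)
  positivity

theorem isStochasticOn_transition [Nonempty V] (hk : 0 < k) {S : Finset (G.Coloring (Fin k))}
    (hS : ∀ α ∈ S, ∀ v c, recolour G α v c ∈ S) : IsStochasticOn (transition G k) S where
  nonneg α β := by
    simp only [transition, Matrix.of_apply]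
    positivity
  sum_eq α := by
    simp only [transition, Matrix.of_apply]
    rw [← Finset.sum_div, ← Nat.cast_sum, ← Finset.card_eq_sum_card_fiberwise
      (f := fun p : V × Fin k => recolour G α p.1 p.2) (fun _ _ => Finset.mem_coe.2 (Finset.mem_univ _)),
      Finset.card_univ, Fintype.card_prod, Fintype.card_fin, Nat.cast_mul]
    have := Fintype.card_pos (α := V)
    exact div_self (by positivity)
  closed α hα β hβ := by
    simp only [transition, Matrix.of_apply]
    rw [Finset.card_eq_zero.2, Nat.cast_zero, zero_div]
    refine Finset.filter_eq_empty_iff.2 fun p _ h => hβ ?_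
    rw [← h]
    exact hS α hα p.1 p.2

theorem exists_pow_transition_pos [Nonempty V] {α β : G.Coloring (Fin k)}
    (h : Reach G (α : V → Fin k) β) : ∃ t, 0 < (transition G k ^ t) α β := by
  rcases isEmpty_or_nonempty (Fin k) with hk | hk
  · exact (hk.false (α (Classical.arbitrary V))).elim
  have hk : 0 < k := Fin.pos (Classical.arbitrary (Fin k))
  have hP : IsStochasticOn (transition G k) Finset.univ :=
    isStochasticOn_transition hk fun _ _ _ _ => Finset.mem_univ _
  suffices ∀ f : V → Fin k, Reach G α f → ∀ β : G.Coloring (Fin k), (β : V → Fin k) = f →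
      ∃ t, 0 < (transition G k ^ t) α β from this β h β rfl
  intro f hf
  induction hf with
  | refl =>
    intro β hβ
    rw [DFunLike.coe_injective hβ]
    exact ⟨0, by simp⟩
  | @tail g f _ hs ih =>
    intro β hβ
    obtain ⟨hg, hf, u, c, rfl⟩ := hs
    set γ : G.Coloring (Fin k) := SimpleGraph.Coloring.mk g fun {a b} hab => hg a b hab with hγ
    have hγg : (γ : V → Fin k) = g := rfl
    obtain ⟨t, ht⟩ := ih γ hγg
    have hr : recolour G γ u c = β := by
      apply DFunLike.coe_injective
      rw [hβ, coe_recolour fun w huw => ?_, hγg]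
      have := hf u w huw
      rw [update_self, update_of_ne huw.ne'] at this
      exact this.symm
    refine ⟨t + 1, ?_⟩
    rw [pow_succ, Matrix.mul_apply]
    exact Finset.sum_pos' (fun δ _ => mul_nonneg ((hP.pow t).nonneg α δ) (hP.nonneg δ β))
      ⟨γ, Finset.mem_univ γ, mul_pos ht (transition_pos hr)⟩

theorem recolour_mem_nonFrozen {α : G.Coloring (Fin k)} (hα : α ∈ nonFrozen G k) (v : V)
    (c : Fin k) : recolour G α v c ∈ nonFrozen G k := by
  simp only [nonFrozen, Finset.mem_filter, Finset.mem_univ, true_and] at *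
  exact not_isFrozen_recolour hα rfl

/-- Glauber dynamics started at a colouring that is not frozen converges to the uniform
distribution on such colourings. -/
theorem tendsto_tvDist_law (hG : G.Connected) (hk : 4 ≤ k)
    (hdeg : ∀ v, (nbhd G v).card + 1 ≤ k) {α : G.Coloring (Fin k)} (hα : α ∈ nonFrozen G k) :
    Tendsto (fun t => tvDist (law G k (pointMass α) t) (uniformOn (nonFrozen G k))) atTop
      (𝓝 0) := by
  have := hG.nonempty
  refine (isStochasticOn_transition (by omega)
    fun α hα => recolour_mem_nonFrozen hα).tendsto_tvDist transition_symm
    (fun a => transition_pos (recolour_self a (Classical.arbitrary V))) (fun a ha b hb => ?_) hα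
  simp only [nonFrozen, Finset.mem_filter, Finset.mem_univ, true_and, not_isFrozen_iff] at ha hb
  exact exists_pow_transition_pos
    (reach_of_free hG.preconnected hk hdeg (proper_coe a) (proper_coe b) ha hb)

theorem law_uniformOn [Nonempty V] (hk : 0 < k) (t : ℕ) :
    law G k (uniformOn (colourings G k)) t = uniformOn (colourings G k) :=
  (isStochasticOn_transition hk fun _ _ _ _ => Finset.mem_univ _).uniformOn_vecMul_pow
    transition_symm t

end Chain

/-! ### Frozen colourings are rare. -/

section FrozenFraction

open scoped Classical
open Function Relation

variable {V : Type*} [Fintype V] {k : ℕ} {G : SimpleGraph V}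

theorem IsFrozen.eq_of_eq {α : G.Coloring (Fin k)} (hα : IsFrozen G α)
    (hdeg : ∀ v, (nbhd G v).card + 1 ≤ k) {s a b : V} (ha : a = s ∨ G.Adj s a)
    (hb : b = s ∨ G.Adj s b) (hab : α a = α b) : a = b :=
  eq_of_not_free hdeg (v := s)
    (fun h => not_exists.1 (mt (not_isFrozen_iff α).2 (not_not.2 hα)) s h) ha hb hab

theorem IsFrozen.card_nbhd {α : G.Coloring (Fin k)} (hα : IsFrozen G α)
    (hdeg : ∀ v, (nbhd G v).card + 1 ≤ k) (v : V) : (nbhd G v).card + 1 = k := by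
  refine le_antisymm (hdeg v) ?_
  have : (Finset.univ : Finset (Fin k)) ⊆ (insert v (nbhd G v)).image α := by
    intro c _
    obtain ⟨u, hu, rfl⟩ := hα v c
    exact Finset.mem_image_of_mem _ (by simpa using hu)
  have h := Finset.card_le_card this
  rw [Finset.card_univ, Fintype.card_fin] at h
  exact (h.trans Finset.card_image_le).trans (Finset.card_insert_le _ _)

/-- A regular connected graph that is not complete has no vertex whose neighbours form a clique. -/
theorem exists_nonadj_nbhd (hG : G.Preconnected) (hreg : ∀ v, (nbhd G v).card + 1 = k)
    (hk : k < Fintype.card V) (v : V) : ∃ u w, G.Adj v u ∧ G.Adj v w ∧ w ≠ u ∧ ¬ G.Adj w u := by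
  by_contra! h
  have hcard : (insert v (nbhd G v)).card = k := by
    rw [Finset.card_insert_of_notMem (by simp), hreg]
  have hadj : ∀ s ∈ insert v (nbhd G v), ∀ t ∈ insert v (nbhd G v), s ≠ t → G.Adj s t := by
    intro s hs t ht hst
    simp only [Finset.mem_insert, mem_nbhd] at hs ht
    rcases hs with rfl | hs <;> rcases ht with rfl | ht
    · exact absurd rfl hst
    · exact ht
    · exact hs.symm
    · exact h t s ht hs hst
  have hall : ∀ u, u ∈ insert v (nbhd G v) := mem_of_closed hG (a := v) (by simp)
    (fun s t hs hst => by
      have hsub : (insert v (nbhd G v)).erase s ⊆ nbhd G s := by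
        intro t ht
        rw [Finset.mem_erase] at ht
        simpa using hadj s hs t ht.2 ht.1.symm
      -- By regularity a closed neighbourhood that is a clique has no edges leaving it, so by
      -- connectivity it would contain all vertices.
      have := Finset.eq_of_subset_of_card_le hsub (by
        rw [Finset.card_erase_of_mem hs, hcard]
        have := hreg s
        omega)
      have ht : t ∈ nbhd G s := by simpa using hst
      rw [← this] at ht
      exact Finset.mem_of_mem_erase ht)
  have := Finset.card_le_card (fun u _ => hall u : Finset.univ ⊆ insert v (nbhd G v))
  rw [hcard, Finset.card_univ] at this
  omega

/-- Exchanging the colours of two adjacent vertices keeps a frozen colouring proper. -/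
theorem IsFrozen.proper_swap {α : G.Coloring (Fin k)} (hα : IsFrozen G α)
    (hdeg : ∀ v, (nbhd G v).card + 1 ≤ k) {v u : V} (huv : G.Adj v u) :
    Proper G (α ∘ Equiv.swap v u) := by
  -- In a frozen colouring the closed neighbourhoods are rainbow, so the colour moved to `a` occurs
  -- at no other neighbour of `a`.
  have h1 : ∀ a b c, G.Adj a c → G.Adj a b → b ≠ c → α c ≠ α b := fun a b c hc hb hbc e =>
    hbc (hα.eq_of_eq hdeg (.inr hc) (.inr hb) e).symm
  have h2 : ∀ a b, a = v ∨ a = u → b ≠ v → b ≠ u → G.Adj a b →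
      α (Equiv.swap v u a) ≠ α (Equiv.swap v u b) := by
    intro a b ha hbv hbu hab
    rw [Equiv.swap_apply_of_ne_of_ne hbv hbu]
    rcases ha with rfl | rfl
    · rw [Equiv.swap_apply_left]
      exact h1 a b u huv hab hbu
    · rw [Equiv.swap_apply_right]
      exact h1 a b v huv.symm hab hbv
  intro a b hab
  simp only [comp_apply]
  by_cases ha : a = v ∨ a = u <;> by_cases hb : b = v ∨ b = u
  · rcases ha with rfl | rfl <;> rcases hb with rfl | rfl
    · exact absurd hab (G.loopless.irrefl _)
    · simpa using (α.valid hab).symm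
    · simpa using (α.valid hab).symm
    · exact absurd hab (G.loopless.irrefl _)
  · rw [not_or] at hb
    exact h2 a b ha hb.1 hb.2 hab
  · rw [not_or] at ha
    exact (h2 b a hb ha.1 ha.2 hab.symm).symm
  · rw [not_or] at ha hb
    rw [Equiv.swap_apply_of_ne_of_ne ha.1 ha.2, Equiv.swap_apply_of_ne_of_ne hb.1 hb.2]
    exact α.valid hab

omit [Fintype V] in
/-- A free vertex of a frozen colouring with the colours of `v` and `u` exchanged is a neighbour of
exactly one of `v` and `u`, whose original colour is the one missing. -/
theorem IsFrozen.missing_of_swap {α : G.Coloring (Fin k)} (hα : IsFrozen G α)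
    {v u w : V} {c : Fin k} (huv : G.Adj v u)
    (hc : ∀ t, t = w ∨ G.Adj w t → (α ∘ Equiv.swap v u) t ≠ c) :
    (G.Adj w v ∧ α v = c) ∨ (G.Adj w u ∧ α u = c) := by
  obtain ⟨t, ht, htc⟩ := hα w c
  have h := hc t ht
  simp only [comp_apply] at h hc
  by_cases htv : t = v
  · subst htv
    refine .inl ⟨ht.resolve_left ?_, htc⟩
    rintro rfl
    exact hc u (.inr huv) (by simpa using htc)
  by_cases htu : t = u
  · subst htu
    refine .inr ⟨ht.resolve_left ?_, htc⟩
    rintro rfl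
    exact hc v (.inr huv.symm) (by simpa using htc)
  rw [Equiv.swap_apply_of_ne_of_ne htv htu] at h
  exact absurd htc h

/-- Double counting of pairs of a frozen `α` and a vertex `v`, sent to `α` with the colours of `v`
and a neighbour `u v` exchanged. Here `w v` is a neighbour of `v` not adjacent to `u v`: it loses
the colour `α v`, so the image is not frozen. -/
theorem card_frozen_mul_le (hG : G.Preconnected) (hdeg : ∀ v, (nbhd G v).card + 1 ≤ k)
    (hk : k < Fintype.card V) :
    (frozen G k).card * Fintype.card V ≤ 2 * k * (nonFrozen G k).card := by
  rcases (frozen G k).eq_empty_or_nonempty with h | ⟨α₀, hα₀⟩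
  · simp [h]
  have mem_frozen : ∀ {α : G.Coloring (Fin k)}, α ∈ frozen G k ↔ IsFrozen G α := by
    simp [frozen]
  have hreg := (mem_frozen.1 hα₀).card_nbhd hdeg
  choose u w huv hvw hwu hnadj using exists_nonadj_nbhd hG hreg hk
  rw [← Finset.card_univ, ← Finset.card_product]
  refine (Finset.card_le_mul_card_image_of_maps_to
    (f := fun p : G.Coloring (Fin k) × V => (p.1 : V → Fin k) ∘ Equiv.swap p.2 (u p.2))
    (t := (nonFrozen G k).image (DFunLike.coe : G.Coloring (Fin k) → V → Fin k)) ?_ (2 * k) ?_).trans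
      (Nat.mul_le_mul_left _ Finset.card_image_le)
  · rintro ⟨α, v⟩ hp
    have hα : IsFrozen G α := mem_frozen.1 (Finset.mem_product.1 hp).1
    have hprop := hα.proper_swap hdeg (huv v)
    refine Finset.mem_image.2 ⟨SimpleGraph.Coloring.mk _ fun {a b} hab => hprop a b hab, ?_, rfl⟩
    simp only [nonFrozen, Finset.mem_filter, Finset.mem_univ, true_and, not_isFrozen_iff]
    refine ⟨w v, α v, fun t ht => ?_⟩
    change α (Equiv.swap v (u v) t) ≠ α v
    by_cases htv : t = v
    · subst htv
      rw [Equiv.swap_apply_left]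
      exact (α.valid (huv t)).symm
    by_cases htu : t = u v
    · rcases ht with ht | ht
      · exact absurd (ht.symm.trans htu) (hwu v)
      · exact absurd (htu ▸ ht) (hnadj v)
    rw [Equiv.swap_apply_of_ne_of_ne htv htu]
    exact fun e => htv (hα.eq_of_eq hdeg ht (.inr (hvw v).symm) e)
  · intro γ hγ
    obtain ⟨β, hβ, rfl⟩ := Finset.mem_image.1 hγ
    simp only [nonFrozen, Finset.mem_filter, Finset.mem_univ, true_and, not_isFrozen_iff] at hβ
    obtain ⟨x, c, hc⟩ := hβ
    have hfib : ∀ p ∈ (frozen G k ×ˢ Finset.univ).filter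
        (fun p : G.Coloring (Fin k) × V => (p.1 : V → Fin k) ∘ Equiv.swap p.2 (u p.2) = β),
        IsFrozen G p.1 ∧ (p.1 : V → Fin k) ∘ Equiv.swap p.2 (u p.2) = β ∧
        ((G.Adj x p.2 ∧ p.1 p.2 = c) ∨ (G.Adj x (u p.2) ∧ p.1 (u p.2) = c)) := by
      intro p hp
      rw [Finset.mem_filter, Finset.mem_product] at hp
      have hα := mem_frozen.1 hp.1.1
      exact ⟨hα, hp.2, hα.missing_of_swap (huv p.2) (hp.2.symm ▸ hc)⟩
    -- For a fixed image with free vertex `x`, either `v` or `u v` is a neighbour of `x`. Recording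
    -- which one, and the Boolean telling the cases apart, leaves at most `2(k - 1)` preimages.
    refine (Finset.card_le_card_of_injOn
      (t := nbhd G x ×ˢ (Finset.univ : Finset Bool))
      (fun p => if G.Adj x p.2 then (p.2, true) else (u p.2, false)) ?_ ?_).trans ?_
    · intro p hp
      obtain ⟨-, -, h⟩ := hfib p hp
      simp only [Finset.mem_coe, Finset.mem_product, Finset.mem_univ, and_true, mem_nbhd]
      split_ifs with hx
      · exact hx
      · exact (h.resolve_left fun h => hx h.1).1
    · rintro ⟨α, v⟩ hp ⟨α', v'⟩ hp' he
      obtain ⟨hα, e, h⟩ := hfib _ hp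
      obtain ⟨hα', e', h'⟩ := hfib _ hp'
      simp only at e e' h h' he
      suffices hv : v = v' by
        subst hv
        refine Prod.ext (DFunLike.coe_injective ?_) rfl
        exact (Equiv.swap v (u v)).surjective.injective_comp_right (e.trans e'.symm)
      split_ifs at he with h1 h2 h2
      · exact (Prod.ext_iff.1 he).1
      · exact absurd (Prod.ext_iff.1 he).2 (by simp)
      · exact absurd (Prod.ext_iff.1 he).2 (by simp)
      · have hu : u v = u v' := (Prod.ext_iff.1 he).1
        have hs : α (u v) = c := (h.resolve_left fun h => h1 h.1).2
        have hs' : α' (u v') = c := (h'.resolve_left fun h => h2 h.1).2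
        -- In the second case `v` is recovered from `u v` as its only neighbour with colour `c` in
        -- `β`: another one, `v'`, would have colour `c` in `α` too, as does the adjacent `u v`.
        by_contra hvv
        have h3 : β v' = c := by rw [← e']; simpa using hs'
        have hne : v' ≠ u v := hu ▸ (huv v').ne
        rw [← e, comp_apply, Equiv.swap_apply_of_ne_of_ne (Ne.symm hvv) hne] at h3
        exact α.valid (hu ▸ huv v' : G.Adj v' (u v)) (h3.trans hs.symm)
    · rw [Finset.card_product, Finset.card_univ, Fintype.card_bool]
      have := hdeg x
      nlinarith

end FrozenFraction

/-! ### Asymptotic bounds. -/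

section Limits

open scoped Classical

theorem nbhd_card_le_maxDegree {V : Type*} [Fintype V] (G : SimpleGraph V) [DecidableRel G.Adj]
    (v : V) : (nbhd G v).card + 1 ≤ G.maxDegree + 1 := by
  have : nbhd G v = G.neighborFinset v := by ext; simp
  rw [this, SimpleGraph.card_neighborFinset_eq_degree]
  exact Nat.succ_le_succ (G.degree_le_maxDegree v)

theorem compl_nonFrozen {V : Type*} [Fintype V] (G : SimpleGraph V) (k : ℕ) :
    (nonFrozen G k)ᶜ = frozen G k := by
  ext α
  simp [nonFrozen, frozen]

theorem card_colourings_pos {V : Type*} [Fintype V] {G : SimpleGraph V} {k : ℕ} (hk : 0 < k)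
    (hdeg : ∀ v, (nbhd G v).card + 1 ≤ k) : 0 < (colourings G k).card := by
  obtain ⟨f, hf, -⟩ := exists_proper_extend hdeg Finset.univ (f := fun _ => ⟨0, hk⟩) (by simp)
  exact Finset.card_pos.2 ⟨SimpleGraph.Coloring.mk f fun {a b} hab => hf a b hab,
    Finset.mem_univ _⟩

theorem card_frozen_div_le {V : Type*} [Fintype V] {G : SimpleGraph V} {k : ℕ}
    (hG : G.Preconnected) (h0 : 0 < k) (hdeg : ∀ v, (nbhd G v).card + 1 ≤ k)
    (hk : k < Fintype.card V) :
    ((frozen G k).card : ℝ) / (colourings G k).card ≤ 2 * k / Fintype.card V := by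
  have hc : (0 : ℝ) < (colourings G k).card := by exact_mod_cast card_colourings_pos h0 hdeg
  have hV : (0 : ℝ) < Fintype.card V := by exact_mod_cast h0.trans hk
  rw [div_le_div_iff₀ hc hV]
  have h1 := card_frozen_mul_le hG hdeg hk
  have h2 : (nonFrozen G k).card ≤ (colourings G k).card :=
    Finset.card_le_card (Finset.subset_univ _)
  exact_mod_cast h1.trans (Nat.mul_le_mul_left _ h2)

/-- All non-frozen colourings are good starts from a common time on, as there are finitely many of
them, and they make up more than a fraction `1 - ε`. -/
theorem exists_mul_card_le_card_goodStarts {V : Type*} [Fintype V] {G : SimpleGraph V} {k : ℕ}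
    (hG : G.Connected) (hk : 4 ≤ k) (hdeg : ∀ v, (nbhd G v).card + 1 ≤ k) {ε : ℝ}
    (hf : ((frozen G k).card : ℝ) / (colourings G k).card < ε)
    (htv : tvDist (uniformOn (nonFrozen G k)) (uniformOn (colourings G k)) < ε) :
    ∃ T, (1 - ε) * ((colourings G k).card : ℝ) ≤ ((goodStarts G k ε T).card : ℝ) := by
  have hev : ∀ᶠ t in atTop, ∀ α ∈ nonFrozen G k, tvDist (law G k (pointMass α) t)
      (uniformOn (nonFrozen G k)) <
        ε - tvDist (uniformOn (nonFrozen G k)) (uniformOn (colourings G k)) :=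
    (Filter.eventually_all_finset _).2 fun α hα =>
      (tendsto_tvDist_law hG hk hdeg hα).eventually_lt_const (sub_pos.2 htv)
  obtain ⟨T, hT⟩ := eventually_atTop.1 hev
  refine ⟨T, ?_⟩
  have hsub : nonFrozen G k ⊆ goodStarts G k ε T := by
    intro α hα
    simp only [goodStarts, Finset.mem_filter, Finset.mem_univ, true_and]
    intro t ht
    have h1 := tvDist_triangle (law G k (pointMass α) t) (uniformOn (nonFrozen G k))
      (uniformOn (colourings G k))
    have h2 := hT t ht α hα
    linarith
  have h1 : ((nonFrozen G k).card : ℝ) ≤ (goodStarts G k ε T).card := by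
    exact_mod_cast Finset.card_le_card hsub
  have h2 : ((nonFrozen G k).card : ℝ) + (frozen G k).card = (colourings G k).card := by
    rw [← compl_nonFrozen]
    exact_mod_cast Finset.card_add_card_compl (nonFrozen G k)
  have hc : (0 : ℝ) < (colourings G k).card := by
    exact_mod_cast card_colourings_pos (by omega) hdeg
  rw [div_lt_iff₀ hc] at hf
  linarith

end Limits

end GlauberColouring

/-! ### The main theorem. -/

theorem mainTheorem7
    (n : ℕ → ℕ) (G : ∀ i, SimpleGraph (Fin (n i))) [∀ i, DecidableRel (G i).Adj]
    (hn : Tendsto n atTop atTop)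
    (hΔ : (fun i => ((G i).maxDegree : ℝ)) =o[atTop] (fun i => (n i : ℝ))) :
    -- the colouring `X_t` obtained from a uniformly random start, averaged over the start
    (∀ ε : ℝ, 0 < ε → ∀ᶠ i in atTop, ∀ t : ℕ,
      GlauberColouring.tvDist
        (GlauberColouring.law (G i) ((G i).maxDegree + 1)
          (GlauberColouring.uniformOn
            (GlauberColouring.colourings (G i) ((G i).maxDegree + 1))) t)
        (GlauberColouring.uniformOn
          (GlauberColouring.colourings (G i) ((G i).maxDegree + 1))) ≤ ε) ∧
    ((∀ i, (G i).Connected) → (∀ i, 3 ≤ (G i).maxDegree) →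
      -- for most starts, the chain run from that start becomes almost uniform
      (∀ ε : ℝ, 0 < ε → ∀ᶠ i in atTop, ∃ T : ℕ,
        (1 - ε) * ((GlauberColouring.colourings (G i) ((G i).maxDegree + 1)).card : ℝ) ≤
          ((GlauberColouring.goodStarts (G i) ((G i).maxDegree + 1) ε T).card : ℝ)) ∧
      -- frozen colourings are a vanishing fraction of all colourings
      Tendsto (fun i =>
          ((GlauberColouring.frozen (G i) ((G i).maxDegree + 1)).card : ℝ) /
            ((GlauberColouring.colourings (G i) ((G i).maxDegree + 1)).card : ℝ))
        atTop (𝓝 0) ∧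
      -- from a non-frozen start, the chain converges to uniform on the non-frozen colourings
      (∀ i, ∀ α ∈ GlauberColouring.nonFrozen (G i) ((G i).maxDegree + 1),
        Tendsto (fun t : ℕ =>
            GlauberColouring.tvDist
              (GlauberColouring.law (G i) ((G i).maxDegree + 1)
                (GlauberColouring.pointMass α) t)
              (GlauberColouring.uniformOn
                (GlauberColouring.nonFrozen (G i) ((G i).maxDegree + 1))))
          atTop (𝓝 0)) ∧
      -- and this limit law is almost uniform on all colourings
      Tendsto (fun i =>
          GlauberColouring.tvDist
            (GlauberColouring.uniformOn
              (GlauberColouring.nonFrozen (G i) ((G i).maxDegree + 1)))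
            (GlauberColouring.uniformOn
              (GlauberColouring.colourings (G i) ((G i).maxDegree + 1))))
        atTop (𝓝 0))
:= by
  classical
  open GlauberColouring in
  have hdeg := fun i => nbhd_card_le_maxDegree (G i)
  refine ⟨fun ε hε => ?_, fun hconn hΔ3 => ?_⟩
  · filter_upwards [hn.eventually_ge_atTop 1] with i hi t
    have : Nonempty (Fin (n i)) := ⟨⟨0, hi⟩⟩
    rw [law_uniformOn (Nat.succ_pos _), tvDist_self]
    exact hε.le
  have hr : Tendsto (fun i => 2 * (((G i).maxDegree + 1 : ℕ) : ℝ) / (n i : ℝ)) atTop (𝓝 0) := by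
    have h1 := hΔ.tendsto_div_nhds_zero
    have h2 : Tendsto (fun i => 1 / (n i : ℝ)) atTop (𝓝 0) :=
      tendsto_one_div_atTop_nhds_zero_nat.comp hn
    have h3 := (h1.add h2).const_mul 2
    rw [add_zero, mul_zero] at h3
    refine h3.congr fun i => ?_
    push_cast
    ring
  have hbig : ∀ᶠ i in atTop, (G i).maxDegree + 1 < n i := by
    filter_upwards [hr.eventually_lt_const one_pos, hn.eventually_ge_atTop 1] with i hi hi'
    have hpos : (0 : ℝ) < n i := by exact_mod_cast hi'
    rw [div_lt_one hpos] at hi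
    have : 2 * ((G i).maxDegree + 1) < n i := by exact_mod_cast hi
    omega
  have ha : Tendsto (fun i => ((frozen (G i) ((G i).maxDegree + 1)).card : ℝ) /
      ((colourings (G i) ((G i).maxDegree + 1)).card : ℝ)) atTop (𝓝 0) := by
    refine squeeze_zero' (Eventually.of_forall fun i => by positivity) ?_ hr
    filter_upwards [hbig] with i hi
    simpa using card_frozen_div_le (hconn i).preconnected (Nat.succ_pos _) (hdeg i)
      (by simpa using hi)
  have hc : Tendsto (fun i => tvDist (uniformOn (nonFrozen (G i) ((G i).maxDegree + 1)))
      (uniformOn (colourings (G i) ((G i).maxDegree + 1)))) atTop (𝓝 0) := by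
    refine squeeze_zero' (Eventually.of_forall fun i => tvDist_nonneg _ _) ?_
      (by simpa using ha.const_mul 2)
    -- Once the frozen fraction is below 1 there are non-frozen colourings; on the empty set
    -- `uniformOn` would be zero and not a probability law.
    filter_upwards [ha.eventually_lt_const one_pos] with i hi
    have hpos : (0 : ℝ) < (colourings (G i) ((G i).maxDegree + 1)).card := by
      exact_mod_cast card_colourings_pos (Nat.succ_pos _) (hdeg i)
    have hne : (nonFrozen (G i) ((G i).maxDegree + 1)).Nonempty := by
      rw [Finset.nonempty_iff_ne_empty]
      intro he
      have h1 := compl_nonFrozen (G i) ((G i).maxDegree + 1)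
      rw [he, Finset.compl_empty] at h1
      rw [← h1] at hi
      exact hi.ne (div_self hpos.ne')
    have h := tvDist_uniformOn_univ_le hne
    rw [compl_nonFrozen] at h
    exact h
  refine ⟨fun ε hε => ?_, ha, fun i α hα => ?_, hc⟩
  · filter_upwards [ha.eventually_lt_const hε, hc.eventually_lt_const hε] with i h1 h2
    exact exists_mul_card_le_card_goodStarts (hconn i) (Nat.succ_le_succ (hΔ3 i)) (hdeg i) h1 h2
  · exact tendsto_tvDist_law (hconn i) (Nat.succ_le_succ (hΔ3 i)) (hdeg i) hα
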